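/- \textbf{Setting.} Let $k\ge 1$ be an integer, $\rho>0$ a real, $r=\rho 2^k/k$ and $m=\lceil rn\rceil$. Let $\Phi$ be a set of $m$ clauses chosen uniformly at random among the sets of $m$ out of the $2^k\binom nk$ clauses of length $k$ over the variables $x_1,\dots,x_n$ (a clause of length $k$ is a set of $k$ literals with distinct underlying variables), conditioned on being satisfiable. \emph{Decimation process.} Let $\Phi_0=\Phi$. For $t=1,\dots,n$ let $M_{x_t}(\Phi_{t-1})$ be the fraction of the satisfying assignments of $\Phi_{t-1}$ (a formula on $x_t,\dots,x_n$) in which $x_t$ takes the value $1$; set $\sigma(x_t)=1$ with probability $M_{x_t}(\Phi_{t-1})$ and $\sigma(x_t)=0$ otherwise; and obtain $\Phi_t$ from $\Phi_{t-1}$ by substituting $\sigma(x_t)$ for $x_t$, deleting all clauses that got satisfied, and omitting $x_t$ from all other clauses (clauses keep their identity, so distinct clauses may become equal as sets of literals). \emph{BP marginals.} For a formula $\Psi$ let $N(a)$ be the set of variables occurring in the clause $a$, let $N(x)$ be the set of clauses in which the variable $x$ occurs, and for $x\in N(a)$ let $s(x,a)\in\{0,1\}$ be the value of $x$ that satisfies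 $a$. Given messages $\mu_{x\to a}(\zeta)\in[0,1]$ ($a\in N(x)$, $\zeta\in\{0,1\}$) put $\mu_{a\to x}(\zeta)=1$ if $\zeta=s(x,a)$, and $\mu_{a\to x}(\zeta)=1-\prod_{y\in N(a)\setminus\{x\}}\mu_{y\to a}(1-s(y,a))$ otherwise. Define $$(\mathrm{BP}(\mu))_{x\to a}(\zeta)=\frac{\prod_{b\in N(x)\setminus\{a\}}\mu_{b\to x}(\zeta)}{\prod_{b\in N(x)\setminus\{a\}}\mu_{b\to x}(0)+\prod_{b\in N(x)\setminus\{a\}}\mu_{b\to x}(1)},$$ or $\frac12$ if the denominator is zero. Let $\mu[0]$ be the family with all entries $\frac12$, let $\mu[\ell]=\mathrm{BP}(\mu[\ell-1])$ for $\ell\ge1$, and let $$\mu_x(\Psi,\omega)=\frac{\prod_{b\in N(x)}\mu_{b\to x}(1)[\omega]}{\prod_{b\in N(x)}\mu_{b\to x}(0)[\omega]+\prod_{b\in N(x)}\mu_{b\to x}(1)[\omega]},$$ or $\frac12$ if the denominator is zero, where $\mu_{b\to x}[\omega]$ is computed from $\mu[\omega]$. \emph{Hypothesis $H(k,\rho)$.}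 For every $\varepsilon>0$ there is a function $\omega=\omega(n)\ge1$ (integer-valued, possibly depending on $\varepsilon,k,\rho$) such that, with $k,\rho,\varepsilon$ fixed, the probability that $$|\mu_{x_t}(\Phi_{t-1},\omega(n))-M_{x_t}(\Phi_{t-1})|<\varepsilon\quad\text{for all }1\le t\le n$$ tends to $1$ as $n\to\infty$. \textbf{Corollary.} There exist constants $k_0,\rho_0>0$ such that for all integers $k\ge k_0$ and all reals $\rho$ with $\rho_0\le\rho\le k\ln 2-3\ln k$ the hypothesis $H(k,\rho)$ is false. -/

import Mathlib

open Filter Topology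

noncomputable section

namespace DecimationSAT

/-- A clause over the variables `x_1, …, x_n` (indexed by `Fin n`), given as its set of literals.
The literal `(x, true)` is `x`, the literal `(x, false)` is its negation. -/
abbrev Clause (n : ℕ) : Type := Finset (Fin n × Bool)

/-- A propositional formula in conjunctive normal form on the variable set `vars`.
`clauses` is the set of (labels of) its clauses and `lits a` is the set of literals of the clause
with label `a`.  Clauses of different labels are different clauses, even if the omission of
assigned variables leaves them with the same literals. -/
structure CNF (n : ℕ) where
  vars : Finset (Fin n)
  clauses : Finset (Clause n)
  lits : Clause n → Finset (Fin n × Bool)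

namespace CNF

variable {n : ℕ}

/-- The formula on all variables `x_1, …, x_n` whose clauses are the members of `F`. -/
def ofClauses (F : Finset (Clause n)) : CNF n where
  vars := Finset.univ
  clauses := F
  lits := fun a => a

/-- `σ : vars → {0,1}` satisfies the formula: every clause has a literal that is true under `σ`. -/
def Satisfies (Φ : CNF n) (σ : Φ.vars → Bool) : Prop :=
  ∀ a ∈ Φ.clauses, ∃ x : Φ.vars, (x.1, σ x) ∈ Φ.lits a

open Classical in
/-- The set `S(Φ)` of all satisfying assignments of `Φ`. -/
def solutions (Φ : CNF n) : Finset (Φ.vars → Bool) :=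
  Finset.univ.filter fun σ => Φ.Satisfies σ

/-- `Φ` has a satisfying assignment. -/
def Satisfiable (Φ : CNF n) : Prop := ∃ σ, Φ.Satisfies σ

open Classical in
/-- The true marginal `M_x(Φ)`: the fraction of all satisfying assignments of `Φ` in which the
variable `x ∈ vars` takes the value `1`. -/
def marginal (Φ : CNF n) (x : Fin n) : ℝ :=
  ((Φ.solutions.filter fun σ => ∃ h : x ∈ Φ.vars, σ ⟨x, h⟩ = true).card : ℝ) /
    (Φ.solutions.card : ℝ)

/-- Substitute the value `v` for the variable `x` and simplify: delete all clauses that got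
satisfied, and omit `x` from all other clauses. -/
def assign (Φ : CNF n) (x : Fin n) (v : Bool) : CNF n where
  vars := Φ.vars.erase x
  clauses := Φ.clauses.filter fun a => (x, v) ∉ Φ.lits a
  lits := fun a => (Φ.lits a).erase (x, !v)

/-- The formula `Φ_t` obtained from `Φ` by successively substituting `σ(x_1), …, σ(x_t)` for the
first `t` variables and simplifying. -/
def decimate (Φ : CNF n) (σ : Fin n → Bool) : ℕ → CNF n
  | 0 => Φ
  | t + 1 =>
    if h : t < n then (decimate Φ σ t).assign ⟨t, h⟩ (σ ⟨t, h⟩) else decimate Φ σ t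

/-- The probability that the decimation process on input `Φ` outputs `σ`.  One after the other, the
variables are set to `1` with probability equal to the true marginal of the next variable in the
current formula, and to `0` otherwise.  The variable with index `t : Fin n` is the `(t+1)`st
variable, and it is assigned on the basis of the formula in which the first `t` variables have been
substituted. -/
def decimationProb (Φ : CNF n) (σ : Fin n → Bool) : ℝ :=
  ∏ t : Fin n,
    if σ t = true then (Φ.decimate σ t).marginal t else 1 - (Φ.decimate σ t).marginal t

/-! ### Belief Propagation -/

/-- The variables occurring in the clause `a`, i.e. the neighbourhood `N(a)` in the factor graph. -/
def clauseNbr (Φ : CNF n) (a : Clause n) : Finset (Fin n) := (Φ.lits a).image Prod.fst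

/-- The clauses in which the variable `x` occurs, i.e. the neighbourhood `N(x)`. -/
def varNbr (Φ : CNF n) (x : Fin n) : Finset (Clause n) :=
  Φ.clauses.filter fun a => x ∈ Φ.clauseNbr a

/-- The value `(1 + sign(x, a)) / 2` of `x` that satisfies the clause `a`, for `x ∈ N(a)`:
it is `1` if `x` occurs positively in `a`, and `0` otherwise. -/
def satValue (Φ : CNF n) (x : Fin n) (a : Clause n) : Bool := decide ((x, true) ∈ Φ.lits a)

/-- A family of messages `μ_{x → a}(ζ)`.  Only its values at pairs with `a ∈ N(x)` ever matter. -/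
abbrev Messages (n : ℕ) : Type := Fin n → Clause n → Bool → ℝ

/-- The message `μ_{a → x}(ζ)` from the clause `a` to the variable `x` determined by `μ`. -/
def clauseToVar (Φ : CNF n) (μ : Messages n) (a : Clause n) (x : Fin n) (ζ : Bool) : ℝ :=
  if ζ = Φ.satValue x a then 1
  else 1 - ∏ y ∈ (Φ.clauseNbr a).erase x, μ y a (!(Φ.satValue y a))

open Classical in
/-- `p(ζ) / (p(0) + p(1))`, and `1/2` if the denominator is zero. -/
def normalized (p : Bool → ℝ) (ζ : Bool) : ℝ :=
  if p false + p true = 0 then 1 / 2 else p ζ / (p false + p true)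

/-- The Belief Propagation operator. -/
def bp (Φ : CNF n) (μ : Messages n) : Messages n := fun x a =>
  normalized fun ζ => ∏ b ∈ (Φ.varNbr x).erase a, Φ.clauseToVar μ b x ζ

/-- The messages `μ[ℓ]` after `ℓ` iterations, started from the constant family `1/2`. -/
def bpIter (Φ : CNF n) : ℕ → Messages n
  | 0 => fun _ _ _ => 1 / 2
  | ℓ + 1 => Φ.bp (bpIter Φ ℓ)

/-- The BP marginal `μ_x(Φ, ω)`. -/
def bpMarginal (Φ : CNF n) (ω : ℕ) (x : Fin n) : ℝ :=
  normalized (fun ζ => ∏ b ∈ Φ.varNbr x, Φ.clauseToVar (Φ.bpIter ω) b x ζ) true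

end CNF

/-! ### Random formulas -/

open Classical in
/-- All `2 ^ k * n.choose k` clauses of length `k` over `n` variables: sets of `k` literals with
distinct underlying variables. -/
def kClauses (n k : ℕ) : Finset (Clause n) :=
  Finset.univ.filter fun c => c.card = k ∧ Set.InjOn Prod.fst (c : Set (Fin n × Bool))

open Classical in
/-- The satisfiable formulas among the sets of `m` clauses of length `k` over `n` variables. -/
def satFormulas (n k m : ℕ) : Finset (Finset (Clause n)) :=
  ((kClauses n k).powersetCard m).filter fun F => (CNF.ofClauses F).Satisfiable

open Classical in
/-- The probability of the event `E` concerning the pair `(Φ, σ)`, where `Φ` is a uniformly random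
set of `m` clauses of length `k` over `n` variables, conditioned on being satisfiable, and `σ` is
the outcome of the decimation process on `Φ`. -/
def decimationPr (n k m : ℕ) (E : CNF n → (Fin n → Bool) → Prop) : ℝ :=
  (∑ F ∈ satFormulas n k m,
      ∑ σ ∈ Finset.univ.filter (fun σ => E (CNF.ofClauses F) σ),
        (CNF.ofClauses F).decimationProb σ) /
    ((satFormulas n k m).card : ℝ)

/-- The number `m = ⌈r n⌉` of clauses, with density `r = ρ 2^k / k`. -/
def numClauses (k : ℕ) (ρ : ℝ) (n : ℕ) : ℕ := ⌈ρ * 2 ^ k / k * n⌉₊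

/-- The hypothesis underpinning BP decimation, for given `k` and `ρ`: for any `ε > 0` there is
`ω = ω(n) ≥ 1` such that with high probability, at every step of the decimation process, the BP
marginal of the variable to be assigned next differs from its true marginal by less than `ε`. -/
def BPHypothesis (k : ℕ) (ρ : ℝ) : Prop :=
  ∀ ε : ℝ, 0 < ε → ∃ ω : ℕ → ℕ, (∀ n, 1 ≤ ω n) ∧
    Tendsto
      (fun n : ℕ => decimationPr n k (numClauses k ρ n) fun Φ σ =>
        ∀ t : Fin n,
          |(Φ.decimate σ t).bpMarginal (ω n) t - (Φ.decimate σ t).marginal t| < ε)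
      atTop (𝓝 1)

end DecimationSAT

end

/-!
The hypothesis fails because of a short cycle. A formula with linearly many clauses contains, with
probability bounded away from zero, two clauses `a ≠ b` and two variables `x < y` such that, when
`x` is about to be assigned, both clauses have shrunk to the same two literals on `x` and `y`, and no
other clause contains `x` or `y` (`DoubleEdge`). In the decimated formula these four vertices of the
factor graph form a component of their own, a cycle of length four. The cycle carries the constraint
`x ∨ y` (up to signs), so the true marginal of `x` is `2/3` (`DoubleEdge.marginal_eq`). Belief
Propagation counts the constraint twice: the messages for the wrong values follow the recursion
`q ↦ (1 - q) / (2 - q)`, which leaves `[1/3, 1/2]` invariant, so for any number of iterations the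
BP marginal is at least `9/13` (`DoubleEdge.bpMarginal_eq`), and the two marginals differ by at
least `1/39`. Hence a single `ε` below `1/39` refutes the hypothesis, for every choice of `ω`.

It remains to bound below the probability that a double edge exists. The decimation process outputs
a uniformly random satisfying assignment (`decimationProb_ofClauses`), and the number `Z` of double
edges is treated by the second moment method (`second_moment`). All comparisons are between
numbers of satisfiable formulas, by removing or adding clauses one at a time: removing a clause
preserves satisfiability, and so does adding any of the `Θ(n ^ k)` clauses that a given solution
satisfies.

* First moment (`first_moment_lower`). In a random satisfiable formula `H` with two clauses fewer,
  the number of clauses containing `x` or `y` is dominated by a Poisson variable of bounded mean, so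
  `x` and `y` are both isolated with probability bounded below (`card_satFormulas_le_exp_mul`).
  For each solution `σ` of such an `H` there are `Θ(n ^ (2 k - 4))` pairs of clauses that form a
  double edge on `x` and `y`; adding them keeps `σ` a solution and does not create new solutions,
  so the weight `1 / |S(H)|` of `σ` does not decrease.
* Second moment (`second_moment_upper`). Distinct double edges have no clause in common, so `Z ^ 2`
  is at most twice the number of pairs of clauses with two common literals, plus the number of
  pairs of disjoint such pairs, and both numbers have bounded expectation.
-/

noncomputable section

namespace DecimationSAT

variable {n : ℕ}

/-! ### Satisfying assignments of a clause set -/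

/-- The assignment `τ` of all `n` variables satisfies every clause of `F`. -/
def SatBy (F : Finset (Clause n)) (τ : Fin n → Bool) : Prop := ∀ a ∈ F, ∃ i, (i, τ i) ∈ a

open Classical in
/-- The satisfying assignments of the clause set `F`. -/
def sols (F : Finset (Clause n)) : Finset (Fin n → Bool) := Finset.univ.filter fun τ => SatBy F τ

open Classical in
/-- The satisfying assignments of `F` that agree with `σ` on the first `t` variables. -/
def solsFrom (F : Finset (Clause n)) (σ : Fin n → Bool) (t : ℕ) : Finset (Fin n → Bool) :=
  (sols F).filter fun τ => ∀ i : Fin n, i.val < t → τ i = σ i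

lemma mem_sols {F : Finset (Clause n)} {τ : Fin n → Bool} : τ ∈ sols F ↔ SatBy F τ := by
  simp [sols]

lemma mem_solsFrom {F : Finset (Clause n)} {σ τ : Fin n → Bool} {t : ℕ} :
    τ ∈ solsFrom F σ t ↔ SatBy F τ ∧ ∀ i : Fin n, i.val < t → τ i = σ i := by
  simp [solsFrom, mem_sols]

lemma SatBy.mono {F G : Finset (Clause n)} {τ : Fin n → Bool} (h : SatBy G τ) (hFG : F ⊆ G) :
    SatBy F τ := fun a ha => h a (hFG ha)

lemma sols_anti {F G : Finset (Clause n)} (hFG : F ⊆ G) : sols G ⊆ sols F := fun _ h =>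
  mem_sols.2 ((mem_sols.1 h).mono hFG)

lemma satisfiable_ofClauses {F : Finset (Clause n)} :
    (CNF.ofClauses F).Satisfiable ↔ ∃ τ, SatBy F τ := by
  constructor
  · rintro ⟨σ, hσ⟩
    refine ⟨fun i => σ ⟨i, Finset.mem_univ i⟩, fun a ha => ?_⟩
    obtain ⟨x, hx⟩ := hσ a ha
    exact ⟨x.1, hx⟩
  · rintro ⟨τ, hτ⟩
    refine ⟨fun i => τ i.1, fun a ha => ?_⟩
    obtain ⟨x, hx⟩ := hτ a ha
    exact ⟨⟨x, Finset.mem_univ x⟩, hx⟩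

/-! ### The decimated formula -/

lemma decimate_vars (F : Finset (Clause n)) (σ : Fin n → Bool) (t : ℕ) :
    ((CNF.ofClauses F).decimate σ t).vars = Finset.univ.filter fun i : Fin n => t ≤ i.val := by
  induction t with
  | zero => simp [CNF.decimate, CNF.ofClauses]
  | succ t ih =>
    unfold CNF.decimate
    split_ifs with h
    · ext i
      simp only [CNF.assign, ih, Finset.mem_erase, Finset.mem_filter, Finset.mem_univ, true_and,
        Fin.ext_iff, ne_eq]
      omega
    · rw [ih]
      ext i
      have := i.2
      simp only [Finset.mem_filter, Finset.mem_univ, true_and]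
      omega

lemma decimate_lits (F : Finset (Clause n)) (σ : Fin n → Bool) (t : ℕ) (a : Clause n) :
    ((CNF.ofClauses F).decimate σ t).lits a =
      a.filter fun l => ¬ (l.1.val < t ∧ l.2 = !σ l.1) := by
  induction t with
  | zero => simp [CNF.decimate, CNF.ofClauses]
  | succ t ih =>
    unfold CNF.decimate
    split_ifs with h
    · ext ⟨i, v⟩
      simp only [CNF.assign, ih, Finset.mem_erase, Finset.mem_filter, ne_eq, Prod.mk.injEq,
        Order.lt_add_one_iff, Nat.le_iff_lt_or_eq]
      constructor
      · rintro ⟨h1, h2, h3⟩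
        refine ⟨h2, ?_⟩
        rintro ⟨h4 | h4, h5⟩
        · exact h3 ⟨h4, h5⟩
        · have : i = ⟨t, h⟩ := Fin.ext h4
          subst this
          exact h1 ⟨rfl, h5⟩
      · rintro ⟨h1, h2⟩
        refine ⟨?_, h1, fun h3 => h2 ⟨Or.inl h3.1, h3.2⟩⟩
        rintro ⟨rfl, rfl⟩
        exact h2 ⟨Or.inr rfl, rfl⟩
    · rw [ih]
      ext ⟨i, v⟩
      have := i.2
      have e : i.val < t ↔ i.val < t + 1 := by omega
      simp only [Finset.mem_filter, e]

lemma mem_decimate_clauses {F : Finset (Clause n)} {σ : Fin n → Bool} {t : ℕ} {a : Clause n} :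
    a ∈ ((CNF.ofClauses F).decimate σ t).clauses ↔
      a ∈ F ∧ ∀ i : Fin n, i.val < t → (i, σ i) ∉ a := by
  induction t with
  | zero => simp [CNF.decimate, CNF.ofClauses]
  | succ t ih =>
    unfold CNF.decimate
    split_ifs with h
    · simp only [CNF.assign, Finset.mem_filter, ih, decimate_lits, and_assoc]
      refine and_congr_right fun _ => ⟨?_, ?_⟩
      · rintro ⟨h1, h2⟩ i hi
        rcases Nat.lt_or_ge i.val t with h3 | h3
        · exact h1 i h3
        · have : i = ⟨t, h⟩ := Fin.ext (by simp; omega)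
          subst this
          intro h4
          exact h2 ⟨h4, by simp⟩
      · intro h1
        exact ⟨fun i hi => h1 i (by omega), fun h2 => h1 ⟨t, h⟩ (by simp) h2.1⟩
    · rw [ih]
      refine and_congr_right fun _ => forall_congr' fun i => ?_
      have := i.2
      have e : i.val < t ↔ i.val < t + 1 := by omega
      rw [e]

/-- The solutions of the decimated formula are the restrictions of those solutions of the original
formula that extend the assignment made so far. -/
lemma satisfies_decimate_iff {F : Finset (Clause n)} {σ τ : Fin n → Bool} {t : ℕ}
    (h : ∀ i : Fin n, i.val < t → τ i = σ i) :
    ((CNF.ofClauses F).decimate σ t).Satisfies (fun v => τ v.1) ↔ SatBy F τ := by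
  constructor
  · intro hs a ha
    by_cases hc : ∃ i : Fin n, i.val < t ∧ (i, σ i) ∈ a
    · obtain ⟨i, hi, hia⟩ := hc
      exact ⟨i, by rwa [h i hi]⟩
    · push Not at hc
      obtain ⟨x, hx⟩ := hs a (mem_decimate_clauses.2 ⟨ha, hc⟩)
      rw [decimate_lits] at hx
      exact ⟨x.1, (Finset.mem_filter.1 hx).1⟩
  · intro hs a ha
    rw [mem_decimate_clauses] at ha
    obtain ⟨i, hi⟩ := hs a ha.1
    have hti : t ≤ i.val := by
      by_contra hlt
      push Not at hlt
      rw [h i hlt] at hi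
      exact ha.2 i hlt hi
    refine ⟨⟨i, by rw [decimate_vars]; simpa using hti⟩, ?_⟩
    rw [decimate_lits]
    refine Finset.mem_filter.2 ⟨hi, ?_⟩
    simp only
    omega

open Classical in
lemma card_solutions_decimate (F : Finset (Clause n)) (σ : Fin n → Bool) (t : ℕ)
    (p : (((CNF.ofClauses F).decimate σ t).vars → Bool) → Prop) :
    (((CNF.ofClauses F).decimate σ t).solutions.filter p).card =
      ((solsFrom F σ t).filter fun τ => p fun v => τ v.1).card := by
  symm
  refine Finset.card_bij (fun τ _ v => τ v.1) ?_ ?_ ?_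
  · intro τ hτ
    rw [Finset.mem_filter, mem_solsFrom] at hτ
    simp only [CNF.solutions, Finset.mem_filter, Finset.mem_univ, true_and]
    exact ⟨(satisfies_decimate_iff hτ.1.2).2 hτ.1.1, hτ.2⟩
  · intro τ hτ τ' hτ' heq
    rw [Finset.mem_filter, mem_solsFrom] at hτ hτ'
    funext i
    by_cases hi : i.val < t
    · rw [hτ.1.2 i hi, hτ'.1.2 i hi]
    · exact congrFun heq ⟨i, by rw [decimate_vars]; simpa using hi⟩
  · intro ρ hρ
    simp only [CNF.solutions, Finset.mem_filter, Finset.mem_univ, true_and] at hρ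
    let τ : Fin n → Bool := fun i =>
      if h : i ∈ ((CNF.ofClauses F).decimate σ t).vars then ρ ⟨i, h⟩ else σ i
    have hr : (fun v : ((CNF.ofClauses F).decimate σ t).vars => τ v.1) = ρ := by
      funext v
      simp [τ]
    have hag : ∀ i : Fin n, i.val < t → τ i = σ i := by
      intro i hi
      have : i ∉ ((CNF.ofClauses F).decimate σ t).vars := by
        rw [decimate_vars]; simpa using hi
      simp [τ, this]
    refine ⟨τ, ?_, hr⟩
    rw [Finset.mem_filter, mem_solsFrom, hr]
    exact ⟨⟨(satisfies_decimate_iff hag).1 (by rw [hr]; exact hρ.1), hag⟩, hρ.2⟩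

lemma marginal_decimate (F : Finset (Clause n)) (σ : Fin n → Bool) (t : Fin n) :
    ((CNF.ofClauses F).decimate σ t).marginal t =
      (((solsFrom F σ t).filter fun τ => τ t = true).card : ℝ) / ((solsFrom F σ t).card : ℝ) := by
  classical
  unfold CNF.marginal
  have ht : t ∈ ((CNF.ofClauses F).decimate σ t).vars := by
    rw [decimate_vars]; simp
  have h1 := card_solutions_decimate F σ t (fun ρ => ∃ h, ρ ⟨t, h⟩ = true)
  have h2 := card_solutions_decimate F σ t (fun _ => True)
  simp only [Finset.filter_true] at h2
  rw [h2]
  congr 2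
  have h3 : (solsFrom F σ t).filter (fun τ => τ t = true) =
      (solsFrom F σ t).filter (fun τ => ∃ h : t ∈ ((CNF.ofClauses F).decimate σ t).vars,
        (fun v : ((CNF.ofClauses F).decimate σ t).vars => τ v.1) ⟨t, h⟩ = true) :=
    Finset.filter_congr fun τ _ => by simp [ht]
  rw [h3]
  convert h1

/-! ### The decimation process samples a uniformly random satisfying assignment -/

lemma solsFrom_zero (F : Finset (Clause n)) (σ : Fin n → Bool) : solsFrom F σ 0 = sols F := by
  ext τ; simp [mem_solsFrom, mem_sols]

lemma solsFrom_succ (F : Finset (Clause n)) (σ : Fin n → Bool) (t : Fin n) :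
    solsFrom F σ (t + 1) = (solsFrom F σ t).filter fun τ => τ t = σ t := by
  ext τ
  simp only [mem_solsFrom, Finset.mem_filter, and_assoc]
  refine and_congr_right fun _ => ⟨fun h => ⟨fun i hi => h i (by omega), h t (by omega)⟩, ?_⟩
  rintro ⟨h1, h2⟩ i hi
  rcases Nat.lt_or_ge i.val t with h3 | h3
  · exact h1 i h3
  · have : i = t := Fin.ext (by omega)
    rw [this, h2]

open Classical in
lemma card_solsFrom_last (F : Finset (Clause n)) (σ : Fin n → Bool) :
    (solsFrom F σ n).card = if SatBy F σ then 1 else 0 := by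
  split_ifs with h
  · rw [Finset.card_eq_one]
    refine ⟨σ, ?_⟩
    ext τ
    rw [mem_solsFrom, Finset.mem_singleton]
    constructor
    · rintro ⟨-, h2⟩; exact funext fun i => h2 i i.2
    · rintro rfl; exact ⟨h, fun _ _ => rfl⟩
  · rw [Finset.card_eq_zero, Finset.eq_empty_iff_forall_notMem]
    intro τ hτ
    rw [mem_solsFrom] at hτ
    have : τ = σ := funext fun i => hτ.2 i i.2
    exact h (this ▸ hτ.1)

/-- One factor of the telescoping product in `decimationProb`. If no solution is left, the marginal is
the junk value `0 / 0 = 0`, and both sides vanish. -/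
lemma decimation_step (F : Finset (Clause n)) (σ : Fin n → Bool) (t : Fin n) :
    ((solsFrom F σ t).card : ℝ) *
      (if σ t = true then ((CNF.ofClauses F).decimate σ t).marginal t
        else 1 - ((CNF.ofClauses F).decimate σ t).marginal t) = (solsFrom F σ (t + 1)).card := by
  rw [marginal_decimate, solsFrom_succ]
  rcases Nat.eq_zero_or_pos (solsFrom F σ t).card with h0 | h0
  · rw [Finset.card_eq_zero] at h0
    simp [h0]
  · have h0' : ((solsFrom F σ t).card : ℝ) ≠ 0 := by positivity
    have hsum := Finset.card_filter_add_card_filter_not (s := solsFrom F σ t) (fun τ => τ t = true)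
    have hsum' : (((solsFrom F σ t).filter fun τ => τ t = true).card : ℝ) +
        ((solsFrom F σ t).filter fun τ => ¬ τ t = true).card = (solsFrom F σ t).card := by
      exact_mod_cast hsum
    split_ifs with h
    · rw [h]; field_simp
    · rw [Bool.not_eq_true] at h
      simp only [Bool.not_eq_true] at hsum'
      rw [h]
      field_simp
      linarith

open Classical in
/-- The decimation process outputs a uniformly random satisfying assignment. -/
lemma decimationProb_ofClauses (F : Finset (Clause n)) (σ : Fin n → Bool) (hF : (sols F).Nonempty) :
    (CNF.ofClauses F).decimationProb σ = if SatBy F σ then 1 / ((sols F).card : ℝ) else 0 := by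
  set f : Fin n → ℝ := fun t => if σ t = true then ((CNF.ofClauses F).decimate σ t).marginal t
        else 1 - ((CNF.ofClauses F).decimate σ t).marginal t with hf
  have key : ∀ t : ℕ, t ≤ n → ((sols F).card : ℝ) *
      ∏ i ∈ Finset.univ.filter (fun i : Fin n => i.val < t), f i = (solsFrom F σ t).card := by
    intro t
    induction t with
    | zero => intro _; simp [solsFrom_zero]
    | succ t ih =>
      intro ht
      have hins : Finset.univ.filter (fun i : Fin n => i.val < t + 1) =
          insert (⟨t, ht⟩ : Fin n) (Finset.univ.filter fun i : Fin n => i.val < t) := by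
        ext i
        simp only [Finset.mem_filter, Finset.mem_univ, true_and, Finset.mem_insert, Fin.ext_iff]
        omega
      rw [hins, Finset.prod_insert (by simp), mul_left_comm, ih (by omega), mul_comm]
      exact decimation_step F σ ⟨t, ht⟩
  have h1 := key n le_rfl
  have hu : Finset.univ.filter (fun i : Fin n => i.val < n) = Finset.univ := by
    ext i; simp
  have h0 : ((sols F).card : ℝ) ≠ 0 := by
    have := hF.card_pos
    positivity
  rw [hu, card_solsFrom_last] at h1
  unfold CNF.decimationProb
  change ∏ t, f t = _
  split_ifs at h1 ⊢ with h
  · field_simp; simpa [mul_comm] using h1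
  · have : ((sols F).card : ℝ) * ∏ t, f t = 0 := by simpa using h1
    exact (mul_eq_zero.1 this).resolve_left h0

/-! ### Belief Propagation on a double edge -/

/-- Once the variables before `x` are assigned according to `σ`, the clauses `a` and `b` of `F` both
shrink to `{x, y}`, with the literals that are true under `σ`; and no other clause of `F` contains
`x` or `y`.  In the factor graph of the decimated formula, `x, a, y, b` then form a connected
component that is a cycle of length four. -/
structure DoubleEdge (F : Finset (Clause n)) (σ : Fin n → Bool) (x y : Fin n) (a b : Clause n) :
    Prop where
  lt : x < y
  ne : a ≠ b
  mem_left : a ∈ F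
  mem_right : b ∈ F
  fst_left : (x, σ x) ∈ a
  snd_left : (y, σ y) ∈ a
  fst_right : (x, σ x) ∈ b
  snd_right : (y, σ y) ∈ b
  rest_left : ∀ l ∈ a, l = (x, σ x) ∨ l = (y, σ y) ∨ (l.1 < x ∧ l.2 = !σ l.1)
  rest_right : ∀ l ∈ b, l = (x, σ x) ∨ l = (y, σ y) ∨ (l.1 < x ∧ l.2 = !σ l.1)
  only : ∀ c ∈ F, ∀ v, (x, v) ∈ c ∨ (y, v) ∈ c → c = a ∨ c = b

namespace DoubleEdge

variable {F : Finset (Clause n)} {σ : Fin n → Bool} {x y : Fin n} {a b : Clause n}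

lemma symm (h : DoubleEdge F σ x y a b) : DoubleEdge F σ x y b a :=
  ⟨h.lt, h.ne.symm, h.mem_right, h.mem_left, h.fst_right, h.snd_right, h.fst_left, h.snd_left,
    h.rest_right, h.rest_left, fun c hc v hv => (h.only c hc v hv).symm⟩

lemma lits_left (h : DoubleEdge F σ x y a b) :
    ((CNF.ofClauses F).decimate σ x).lits a = {(x, σ x), (y, σ y)} := by
  rw [decimate_lits]
  have hlt : x.val < y.val := h.lt
  ext ⟨i, v⟩
  simp only [Finset.mem_filter, Finset.mem_insert, Finset.mem_singleton]
  constructor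
  · rintro ⟨h1, h2⟩
    rcases h.rest_left _ h1 with h3 | h3 | h3
    · exact Or.inl h3
    · exact Or.inr h3
    · exact absurd h3 h2
  · rintro (h1 | h1)
    · obtain ⟨rfl, rfl⟩ := Prod.mk.inj h1
      exact ⟨h.fst_left, fun h2 => lt_irrefl _ h2.1⟩
    · obtain ⟨rfl, rfl⟩ := Prod.mk.inj h1
      exact ⟨h.snd_left, fun h2 => absurd h2.1 hlt.asymm⟩

lemma mem_clauses_left (h : DoubleEdge F σ x y a b) :
    a ∈ ((CNF.ofClauses F).decimate σ x).clauses := by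
  have hlt : x.val < y.val := h.lt
  refine mem_decimate_clauses.2 ⟨h.mem_left, fun i hi hia => ?_⟩
  rcases h.rest_left _ hia with h3 | h3 | h3
  · have := congrArg (fun l => l.1.val) h3; simp only at this; omega
  · have := congrArg (fun l => l.1.val) h3; simp only at this; omega
  · simp at h3

lemma clauseNbr_left (h : DoubleEdge F σ x y a b) :
    ((CNF.ofClauses F).decimate σ x).clauseNbr a = {x, y} := by
  unfold CNF.clauseNbr
  rw [h.lits_left]
  simp [Finset.image_insert]

lemma mem_of_mem_clauseNbr {F : Finset (Clause n)} {σ : Fin n → Bool} {t : ℕ} {c : Clause n}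
    {z : Fin n} (hz : z ∈ ((CNF.ofClauses F).decimate σ t).clauseNbr c) : ∃ v, (z, v) ∈ c := by
  unfold CNF.clauseNbr at hz
  rw [decimate_lits] at hz
  obtain ⟨⟨i, v⟩, h1, rfl⟩ := Finset.mem_image.1 hz
  exact ⟨v, (Finset.mem_filter.1 h1).1⟩

lemma varNbr_fst (h : DoubleEdge F σ x y a b) :
    ((CNF.ofClauses F).decimate σ x).varNbr x = {a, b} := by
  ext c
  simp only [CNF.varNbr, Finset.mem_filter, Finset.mem_insert, Finset.mem_singleton]
  constructor
  · rintro ⟨h1, h2⟩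
    obtain ⟨v, hv⟩ := mem_of_mem_clauseNbr h2
    exact h.only c (mem_decimate_clauses.1 h1).1 v (Or.inl hv)
  · rintro (rfl | rfl)
    · exact ⟨h.mem_clauses_left, by rw [h.clauseNbr_left]; simp⟩
    · exact ⟨h.symm.mem_clauses_left, by rw [h.symm.clauseNbr_left]; simp⟩

lemma varNbr_snd (h : DoubleEdge F σ x y a b) :
    ((CNF.ofClauses F).decimate σ x).varNbr y = {a, b} := by
  ext c
  simp only [CNF.varNbr, Finset.mem_filter, Finset.mem_insert, Finset.mem_singleton]
  constructor
  · rintro ⟨h1, h2⟩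
    obtain ⟨v, hv⟩ := mem_of_mem_clauseNbr h2
    exact h.only c (mem_decimate_clauses.1 h1).1 v (Or.inr hv)
  · rintro (rfl | rfl)
    · exact ⟨h.mem_clauses_left, by rw [h.clauseNbr_left]; simp⟩
    · exact ⟨h.symm.mem_clauses_left, by rw [h.symm.clauseNbr_left]; simp⟩

lemma satValue_fst (h : DoubleEdge F σ x y a b) :
    ((CNF.ofClauses F).decimate σ x).satValue x a = σ x := by
  unfold CNF.satValue
  rw [h.lits_left]
  have hne : x ≠ y := h.lt.ne
  cases hx : σ x <;> simp [hne]

lemma satValue_snd (h : DoubleEdge F σ x y a b) :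
    ((CNF.ofClauses F).decimate σ x).satValue y a = σ y := by
  unfold CNF.satValue
  rw [h.lits_left]
  have hne : y ≠ x := h.lt.ne'
  cases hy : σ y <;> simp [hne]

lemma clauseToVar_fst (h : DoubleEdge F σ x y a b) (μ : CNF.Messages n) (ζ : Bool) :
    ((CNF.ofClauses F).decimate σ x).clauseToVar μ a x ζ =
      if ζ = σ x then 1 else 1 - μ y a (!σ y) := by
  unfold CNF.clauseToVar
  have he : ({x, y} : Finset (Fin n)).erase x = {y} := by
    rw [Finset.erase_insert]; simpa using h.lt.ne
  rw [h.satValue_fst, h.clauseNbr_left, he, Finset.prod_singleton, h.satValue_snd]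

lemma clauseToVar_snd (h : DoubleEdge F σ x y a b) (μ : CNF.Messages n) (ζ : Bool) :
    ((CNF.ofClauses F).decimate σ x).clauseToVar μ a y ζ =
      if ζ = σ y then 1 else 1 - μ x a (!σ x) := by
  unfold CNF.clauseToVar
  have he : ({x, y} : Finset (Fin n)).erase y = {x} := by
    rw [Finset.pair_comm, Finset.erase_insert]; simpa using h.lt.ne'
  rw [h.satValue_snd, h.clauseNbr_left, he, Finset.prod_singleton, h.satValue_fst]

lemma normalized_not (s : Bool) (q : ℝ) (hq : q ≤ 1 / 2) :
    CNF.normalized (fun ζ => if ζ = s then 1 else 1 - q) (!s) = (1 - q) / (2 - q) := by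
  have h0 : 1 - q + 1 ≠ 0 := by linarith
  have h0' : 1 + (1 - q) ≠ 0 := by linarith
  cases s
  · simp only [CNF.normalized, Bool.not_false]
    simp [h0']; congr 1; ring
  · simp only [CNF.normalized, Bool.not_true]
    simp [h0]; congr 1; ring

lemma div_mem_Icc {q : ℝ} (hq : q ∈ Set.Icc (1 / 3 : ℝ) (1 / 2)) :
    (1 - q) / (2 - q) ∈ Set.Icc (1 / 3 : ℝ) (1 / 2) := by
  obtain ⟨h1, h2⟩ := hq
  have : 0 < 2 - q := by linarith
  constructor
  · rw [div_le_div_iff₀ (by norm_num) this]; linarith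
  · rw [div_le_div_iff₀ this (by norm_num)]; linarith

lemma bp_fst (h : DoubleEdge F σ x y a b) (μ : CNF.Messages n) (hq : μ y b (!σ y) ≤ 1 / 2) :
    ((CNF.ofClauses F).decimate σ x).bp μ x a (!σ x) =
      (1 - μ y b (!σ y)) / (2 - μ y b (!σ y)) := by
  unfold CNF.bp
  have he : ({a, b} : Finset (Clause n)).erase a = {b} := by
    rw [Finset.erase_insert]; simpa using h.ne
  rw [h.varNbr_fst, he]
  simp only [Finset.prod_singleton, h.symm.clauseToVar_fst]
  exact normalized_not _ _ hq

lemma bp_snd (h : DoubleEdge F σ x y a b) (μ : CNF.Messages n) (hq : μ x b (!σ x) ≤ 1 / 2) :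
    ((CNF.ofClauses F).decimate σ x).bp μ y a (!σ y) =
      (1 - μ x b (!σ x)) / (2 - μ x b (!σ x)) := by
  unfold CNF.bp
  have he : ({a, b} : Finset (Clause n)).erase a = {b} := by
    rw [Finset.erase_insert]; simpa using h.ne
  rw [h.varNbr_snd, he]
  simp only [Finset.prod_singleton, h.symm.clauseToVar_snd]
  exact normalized_not _ _ hq

/-- The interval `[1/3, 1/2]` is invariant under the BP recursion `q ↦ (1 - q) / (2 - q)` along the
cycle, so no number of iterations moves the messages out of it. -/
lemma bpIter_mem (h : DoubleEdge F σ x y a b) (ℓ : ℕ) :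
    ((CNF.ofClauses F).decimate σ x).bpIter ℓ x a (!σ x) ∈ Set.Icc (1 / 3 : ℝ) (1 / 2) ∧
    ((CNF.ofClauses F).decimate σ x).bpIter ℓ x b (!σ x) ∈ Set.Icc (1 / 3 : ℝ) (1 / 2) ∧
    ((CNF.ofClauses F).decimate σ x).bpIter ℓ y a (!σ y) ∈ Set.Icc (1 / 3 : ℝ) (1 / 2) ∧
    ((CNF.ofClauses F).decimate σ x).bpIter ℓ y b (!σ y) ∈ Set.Icc (1 / 3 : ℝ) (1 / 2) := by
  induction ℓ with
  | zero => simp only [CNF.bpIter, Set.mem_Icc]; norm_num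
  | succ ℓ ih =>
    obtain ⟨h1, h2, h3, h4⟩ := ih
    simp only [CNF.bpIter]
    rw [h.bp_fst _ h4.2, h.symm.bp_fst _ h3.2, h.bp_snd _ h2.2, h.symm.bp_snd _ h1.2]
    exact ⟨div_mem_Icc h4, div_mem_Icc h3, div_mem_Icc h2, div_mem_Icc h1⟩

/-- The weight `p` of the wrong value satisfies `1/4 ≤ p ≤ 4/9` after any number of iterations. -/
lemma bpMarginal_eq (h : DoubleEdge F σ x y a b) (ω : ℕ) :
    ∃ p : ℝ, 1 / 4 ≤ p ∧ p ≤ 4 / 9 ∧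
      ((CNF.ofClauses F).decimate σ x).bpMarginal ω x =
        if σ x = true then 1 / (1 + p) else p / (1 + p) := by
  obtain ⟨-, -, h3, h4⟩ := h.bpIter_mem ω
  unfold CNF.bpMarginal
  rw [h.varNbr_fst]
  simp only [Finset.prod_pair h.ne, h.clauseToVar_fst, h.symm.clauseToVar_fst]
  generalize ((CNF.ofClauses F).decimate σ x).bpIter ω y a (!σ y) = q at h3 ⊢
  generalize ((CNF.ofClauses F).decimate σ x).bpIter ω y b (!σ y) = q' at h4 ⊢
  obtain ⟨h1, h2⟩ := h3
  obtain ⟨h3, h4⟩ := h4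
  have hp1 : 1 / 4 ≤ (1 - q) * (1 - q') := by nlinarith
  have hp2 : (1 - q) * (1 - q') ≤ 4 / 9 := by nlinarith
  refine ⟨(1 - q) * (1 - q'), hp1, hp2, ?_⟩
  have h0 : (1 - q) * (1 - q') + 1 ≠ 0 := by linarith
  have h0' : 1 + (1 - q) * (1 - q') ≠ 0 := by linarith
  cases σ x
  · simp [CNF.normalized, h0']
  · rw [add_comm] at h0
    simp [CNF.normalized, add_comm _ (1 : ℝ), h0]

/-! ### The true marginal on a double edge -/

lemma satBy_update (h : DoubleEdge F σ x y a b) {τ τ' : Fin n → Bool} (hτ : SatBy F τ)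
    (hxy : τ' x = σ x ∨ τ' y = σ y) (hag : ∀ i, i ≠ x → i ≠ y → τ' i = τ i) : SatBy F τ' := by
  intro c hc
  by_cases hcab : c = a ∨ c = b
  · have hm : (x, σ x) ∈ c ∧ (y, σ y) ∈ c := by
      rcases hcab with rfl | rfl
      · exact ⟨h.fst_left, h.snd_left⟩
      · exact ⟨h.fst_right, h.snd_right⟩
    rcases hxy with h1 | h1
    · exact ⟨x, h1 ▸ hm.1⟩
    · exact ⟨y, h1 ▸ hm.2⟩
  · obtain ⟨i, hi⟩ := hτ c hc
    have hix : i ≠ x := by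
      rintro rfl; exact hcab (h.only c hc _ (Or.inl hi))
    have hiy : i ≠ y := by
      rintro rfl; exact hcab (h.only c hc _ (Or.inr hi))
    exact ⟨i, by rwa [hag i hix hiy]⟩

lemma eq_or_eq_of_mem_solsFrom (h : DoubleEdge F σ x y a b) {τ : Fin n → Bool}
    (hτ : τ ∈ solsFrom F σ x) : τ x = σ x ∨ τ y = σ y := by
  rw [mem_solsFrom] at hτ
  obtain ⟨i, hi⟩ := hτ.1 a h.mem_left
  rcases h.rest_left _ hi with h1 | h1 | ⟨h1, h2⟩
  · simp only [Prod.mk.injEq] at h1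
    obtain ⟨rfl, h1⟩ := h1
    exact Or.inl h1
  · simp only [Prod.mk.injEq] at h1
    obtain ⟨rfl, h1⟩ := h1
    exact Or.inr h1
  · have := hτ.2 i h1
    simp [this] at h2

lemma update_mem_solsFrom (h : DoubleEdge F σ x y a b) {τ : Fin n → Bool}
    (hτ : τ ∈ solsFrom F σ x) (u v : Bool) (huv : u = σ x ∨ v = σ y) :
    Function.update (Function.update τ x u) y v ∈ solsFrom F σ x := by
  have hlt : x.val < y.val := h.lt
  rw [mem_solsFrom] at hτ ⊢
  refine ⟨h.satBy_update hτ.1 ?_ ?_, fun i hi => ?_⟩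
  · simpa [Function.update_of_ne h.lt.ne] using huv
  · intro i h1 h2
    simp [h1, h2]
  · have h1 : i ≠ x := by rintro rfl; omega
    have h2 : i ≠ y := by rintro rfl; omega
    simp [h1, h2, hτ.2 i hi]

/-- The solutions with prescribed admissible values of `x` and `y` are as many as those that agree
with `σ` on both. -/
lemma card_filter_pair (h : DoubleEdge F σ x y a b) (u v : Bool) (huv : u = σ x ∨ v = σ y) :
    ((solsFrom F σ x).filter fun τ => τ x = u ∧ τ y = v).card =
      ((solsFrom F σ x).filter fun τ => τ x = σ x ∧ τ y = σ y).card := by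
  have hxy : x ≠ y := h.lt.ne
  refine Finset.card_bij'
    (fun τ _ => Function.update (Function.update τ x (σ x)) y (σ y))
    (fun τ _ => Function.update (Function.update τ x u) y v) ?_ ?_ ?_ ?_
  · intro τ hτ
    rw [Finset.mem_filter] at hτ ⊢
    exact ⟨h.update_mem_solsFrom hτ.1 _ _ (Or.inl rfl), by simp [hxy], by simp⟩
  · intro τ hτ
    rw [Finset.mem_filter] at hτ ⊢
    exact ⟨h.update_mem_solsFrom hτ.1 _ _ huv, by simp [hxy], by simp⟩
  · intro τ hτ
    rw [Finset.mem_filter] at hτ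
    funext i
    by_cases hy : i = y
    · subst hy; simp [hτ.2.2]
    · by_cases hx : i = x
      · subst hx; simp [hy, hτ.2.1]
      · simp [hx, hy]
  · intro τ hτ
    rw [Finset.mem_filter] at hτ
    funext i
    by_cases hy : i = y
    · subst hy; simp [hτ.2.2]
    · by_cases hx : i = x
      · subst hx; simp [hy, hτ.2.1]
      · simp [hx, hy]

/-- Exactly three of the four pairs of values of `x` and `y` are admissible, and they are equally
likely, so the true marginal of `x` is `2/3` for the value that satisfies the double edge. -/
lemma marginal_eq (h : DoubleEdge F σ x y a b) (hσ : SatBy F σ) :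
    ((CNF.ofClauses F).decimate σ x).marginal x = if σ x = true then 2 / 3 else 1 / 3 := by
  rw [marginal_decimate]
  set S := solsFrom F σ x with hS
  set R := (S.filter fun τ => τ x = σ x ∧ τ y = σ y).card with hR
  have hRpos : 0 < R := Finset.card_pos.2
    ⟨σ, Finset.mem_filter.2 ⟨mem_solsFrom.2 ⟨hσ, fun _ _ => rfl⟩, rfl, rfl⟩⟩
  have split : ∀ u : Bool, (S.filter fun τ => τ x = u).card =
      (S.filter fun τ => τ x = u ∧ τ y = σ y).card +
        (S.filter fun τ => τ x = u ∧ τ y = !σ y).card := by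
    intro u
    rw [← Finset.card_filter_add_card_filter_not (s := S.filter fun τ => τ x = u)
      (fun τ => τ y = σ y), Finset.filter_filter, Finset.filter_filter]
    simp only [Bool.eq_not]
  have h1 : (S.filter fun τ => τ x = σ x).card = 2 * R := by
    rw [split, h.card_filter_pair (σ x) (!σ y) (Or.inl rfl), ← hS, ← hR]; omega
  have h2 : (S.filter fun τ => τ x = !σ x).card = R := by
    rw [split, h.card_filter_pair (!σ x) (σ y) (Or.inr rfl)]
    have : (S.filter fun τ => τ x = (!σ x) ∧ τ y = !σ y) = ∅ := by
      rw [Finset.filter_eq_empty_iff]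
      rintro τ hτ ⟨h3, h4⟩
      rcases h.eq_or_eq_of_mem_solsFrom hτ with h5 | h5
      · simp [h5] at h3
      · simp [h5] at h4
    rw [this, ← hS, ← hR]; simp
  have h3 : S.card = 3 * R := by
    rw [← Finset.card_filter_add_card_filter_not (s := S) (fun τ => τ x = σ x), h1]
    have : (S.filter fun τ => ¬ τ x = σ x) = S.filter fun τ => τ x = !σ x := by
      simp only [Bool.eq_not]
    rw [this, h2]; ring
  have hR' : (R : ℝ) ≠ 0 := by positivity
  rw [h3]
  cases hx : σ x
  · rw [hx] at h2
    simp only [Bool.not_false] at h2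
    rw [h2]
    push_cast
    simp
    field_simp
  · rw [hx] at h1
    rw [h1]
    push_cast
    simp
    field_simp

/-- At a double edge the BP marginal is off by at least `9/13 - 2/3 = 1/39`, whatever the number of
iterations. -/
lemma le_abs_sub (h : DoubleEdge F σ x y a b) (hσ : SatBy F σ) (ω : ℕ) :
    1 / 40 ≤ |((CNF.ofClauses F).decimate σ x).bpMarginal ω x -
      ((CNF.ofClauses F).decimate σ x).marginal x| := by
  obtain ⟨p, hp1, hp2, hp⟩ := h.bpMarginal_eq ω
  rw [hp, h.marginal_eq hσ]
  have h0 : 0 < 1 + p := by linarith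
  split_ifs
  · refine le_trans ?_ (le_abs_self _)
    rw [le_sub_iff_add_le, le_div_iff₀ h0]
    linarith
  · rw [abs_sub_comm]
    refine le_trans ?_ (le_abs_self _)
    rw [le_sub_comm, div_le_iff₀ h0]
    linarith

end DoubleEdge

/-! ### Double counting by removing and adding one element -/

lemma card_mul_le_of_erase {α : Type*} [DecidableEq α] {𝒜 ℬ : Finset (Finset α)} {D : Finset α}
    {d : ℕ} (hd : ∀ F ∈ 𝒜, d ≤ (F ∩ D).card) (h : ∀ F ∈ 𝒜, ∀ c ∈ F ∩ D, F.erase c ∈ ℬ) :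
    𝒜.card * d ≤ ℬ.card * D.card := by
  classical
  refine Finset.card_mul_le_card_mul (fun F H => ∃ c ∈ D, c ∈ F ∧ H = F.erase c) ?_ ?_
  · intro F hF
    refine (hd F hF).trans ?_
    rw [← Finset.card_image_of_injOn (f := fun c => F.erase c) (s := F ∩ D)]
    · refine Finset.card_le_card fun H hH => ?_
      obtain ⟨c, hc, rfl⟩ := Finset.mem_image.1 hH
      exact Finset.mem_filter.2 ⟨h F hF c hc, c, (Finset.mem_inter.1 hc).2,
        (Finset.mem_inter.1 hc).1, rfl⟩
    · exact (Finset.erase_injOn F).mono fun c hc => (Finset.mem_inter.1 hc).1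
  · intro H _
    refine (Finset.card_le_card (t := D.image fun c => insert c H) fun F hF => ?_).trans
      Finset.card_image_le
    obtain ⟨c, hcD, hcF, rfl⟩ := (Finset.mem_filter.1 hF).2
    exact Finset.mem_image.2 ⟨c, hcD, Finset.insert_erase hcF⟩

lemma card_mul_le_of_insert {α : Type*} [DecidableEq α] {𝒜 ℬ : Finset (Finset α)} {e M : ℕ}
    (h : ∀ H ∈ 𝒜, ∃ E : Finset α, e ≤ E.card ∧ ∀ c ∈ E, c ∉ H ∧ insert c H ∈ ℬ)
    (hM : ∀ F ∈ ℬ, F.card ≤ M) : 𝒜.card * e ≤ ℬ.card * M := by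
  classical
  refine Finset.card_mul_le_card_mul (fun H F => ∃ c ∈ F, H = F.erase c) ?_ ?_
  · intro H hH
    obtain ⟨E, hE, hE'⟩ := h H hH
    refine hE.trans ?_
    rw [← Finset.card_image_of_injOn (f := fun c => insert c H) (s := E)]
    · refine Finset.card_le_card fun F hF => ?_
      obtain ⟨c, hc, rfl⟩ := Finset.mem_image.1 hF
      exact Finset.mem_filter.2 ⟨(hE' c hc).2, c, Finset.mem_insert_self _ _,
        (Finset.erase_insert (hE' c hc).1).symm⟩
    · intro c hc c' hc' heq
      have : c ∈ insert c' H := by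
        rw [← show insert c H = insert c' H from heq]; exact Finset.mem_insert_self _ _
      exact (Finset.mem_insert.1 this).resolve_right (hE' c hc).1
  · intro F hF
    refine (Finset.card_le_card (t := F.image fun c => F.erase c) fun H hH => ?_).trans
      (Finset.card_image_le.trans (hM F hF))
    obtain ⟨c, hcF, rfl⟩ := (Finset.mem_filter.1 hH).2
    exact Finset.mem_image.2 ⟨c, hcF, rfl⟩

/-! ### Counting clauses -/

lemma mem_kClauses {k : ℕ} {c : Clause n} :
    c ∈ kClauses n k ↔ c.card = k ∧ Set.InjOn Prod.fst (c : Set (Fin n × Bool)) := by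
  simp [kClauses]

lemma card_kClauses_superset_le (k : ℕ) (L : Finset (Fin n × Bool)) :
    ((kClauses n k).filter fun c => L ⊆ c).card ≤ (2 * n) ^ (k - L.card) := by
  classical
  calc ((kClauses n k).filter fun c => L ⊆ c).card
      ≤ ((Finset.univ : Finset (Fin n × Bool)).powersetCard (k - L.card)).card := by
        refine Finset.card_le_card_of_injOn (fun c => c \ L) ?_ ?_
        · intro c hc
          obtain ⟨h1, h2⟩ := Finset.mem_filter.1 hc
          rw [mem_kClauses] at h1
          rw [Finset.mem_coe, Finset.mem_powersetCard]
          exact ⟨Finset.subset_univ _, by rw [Finset.card_sdiff_of_subset h2, h1.1]⟩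
        · intro c hc c' hc' heq
          have h1 := (Finset.mem_filter.1 hc).2
          have h2 := (Finset.mem_filter.1 hc').2
          rw [← Finset.sdiff_union_of_subset h1, ← Finset.sdiff_union_of_subset h2]
          exact congrArg (· ∪ L) heq
    _ = (2 * n).choose (k - L.card) := by
        rw [Finset.card_powersetCard]
        simp [Fintype.card_prod, mul_comm]
    _ ≤ _ := Nat.choose_le_pow _ _

lemma card_kClauses_le (k : ℕ) : (kClauses n k).card ≤ (2 * n) ^ k := by
  simpa using card_kClauses_superset_le (n := n) k ∅

open Classical in
/-- The `k`-clauses in which `x` or `y` occurs. -/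
def touching (k : ℕ) (x y : Fin n) : Finset (Clause n) :=
  (kClauses n k).filter fun c => ∃ v, (x, v) ∈ c ∨ (y, v) ∈ c

lemma card_touching_le (k : ℕ) (x y : Fin n) :
    (touching k x y).card ≤ 4 * (2 * n) ^ (k - 1) := by
  classical
  have h1 : touching k x y ⊆ (Finset.univ : Finset (Bool × Bool)).biUnion fun p =>
      (kClauses n k).filter fun c => {(if p.1 then x else y, p.2)} ⊆ c := by
    intro c hc
    obtain ⟨h1, v, h2⟩ := Finset.mem_filter.1 hc
    rw [Finset.mem_biUnion]
    rcases h2 with h2 | h2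
    · exact ⟨(true, v), Finset.mem_univ _, Finset.mem_filter.2 ⟨h1, by simpa using h2⟩⟩
    · exact ⟨(false, v), Finset.mem_univ _, Finset.mem_filter.2 ⟨h1, by simpa using h2⟩⟩
  refine (Finset.card_le_card h1).trans ((Finset.card_biUnion_le_card_mul _ _
    ((2 * n) ^ (k - 1)) ?_).trans_eq ?_)
  · intro p _
    simpa using card_kClauses_superset_le k {(if p.1 then x else y, p.2)}
  · rfl

open Classical in
/-- The pairs of distinct `k`-clauses that have at least two literals in common. -/
def sharingPairs (n k : ℕ) : Finset (Clause n × Clause n) :=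
  (kClauses n k ×ˢ kClauses n k).filter fun p =>
    p.1 ≠ p.2 ∧ ∃ l l', l ≠ l' ∧ {l, l'} ⊆ p.1 ∧ {l, l'} ⊆ p.2

lemma card_sharingPairs_le {k : ℕ} (hk : 2 ≤ k) :
    (sharingPairs n k).card ≤ (2 * n) ^ (2 * k - 2) := by
  classical
  have h1 : sharingPairs n k ⊆
      ((Finset.univ : Finset ((Fin n × Bool) × (Fin n × Bool))).filter
        fun q => q.1 ≠ q.2).biUnion fun q =>
      ((kClauses n k).filter fun c => {q.1, q.2} ⊆ c) ×ˢ
        ((kClauses n k).filter fun c => {q.1, q.2} ⊆ c) := by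
    rintro ⟨a, b⟩ hp
    obtain ⟨h1, -, l, l', hl, h2, h3⟩ := Finset.mem_filter.1 hp
    rw [Finset.mem_product] at h1
    exact Finset.mem_biUnion.2 ⟨(l, l'), Finset.mem_filter.2 ⟨Finset.mem_univ _, hl⟩,
      Finset.mem_product.2 ⟨Finset.mem_filter.2 ⟨h1.1, h2⟩, Finset.mem_filter.2 ⟨h1.2, h3⟩⟩⟩
  have h2 : ((Finset.univ : Finset ((Fin n × Bool) × (Fin n × Bool))).filter
        fun q => q.1 ≠ q.2).card ≤ (2 * n) ^ 2 := by
    refine (Finset.card_filter_le _ _).trans_eq ?_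
    simp [Fintype.card_prod]
    ring
  calc (sharingPairs n k).card ≤ (2 * n) ^ 2 * ((2 * n) ^ (k - 2) * (2 * n) ^ (k - 2)) := by
        refine (Finset.card_le_card h1).trans ((Finset.card_biUnion_le_card_mul _ _
          ((2 * n) ^ (k - 2) * (2 * n) ^ (k - 2)) ?_).trans (Nat.mul_le_mul_right _ h2))
        intro q hq
        rw [Finset.card_product]
        have hc : ({q.1, q.2} : Finset (Fin n × Bool)).card = 2 :=
          Finset.card_pair (Finset.mem_filter.1 hq).2
        have := card_kClauses_superset_le k {q.1, q.2}
        rw [hc] at this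
        exact Nat.mul_le_mul this this
    _ = (2 * n) ^ (2 * k - 2) := by
        rw [← pow_add, ← pow_add]; congr 1; omega

/-- The clause on the set `J` of variables whose literals are signed by `s`. -/
def signed (s : Fin n → Bool) (J : Finset (Fin n)) : Clause n := J.image fun i => (i, s i)

lemma mem_signed {s : Fin n → Bool} {J : Finset (Fin n)} {i : Fin n} {v : Bool} :
    (i, v) ∈ signed s J ↔ i ∈ J ∧ v = s i := by
  simp only [signed, Finset.mem_image, Prod.mk.injEq]
  constructor
  · rintro ⟨j, hj, rfl, rfl⟩; exact ⟨hj, rfl⟩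
  · rintro ⟨h, rfl⟩; exact ⟨i, h, rfl, rfl⟩

lemma signed_injective (s : Fin n → Bool) : Function.Injective (signed s) := by
  intro J J' h
  ext i
  have := congrArg (fun c : Clause n => (i, s i) ∈ c) h
  simpa [mem_signed] using this

lemma signed_mem_kClauses (s : Fin n → Bool) (J : Finset (Fin n)) :
    signed s J ∈ kClauses n J.card := by
  rw [mem_kClauses]
  constructor
  · exact Finset.card_image_of_injective _ fun i j h => (Prod.mk.inj h).1
  · rintro ⟨i, v⟩ h1 ⟨j, w⟩ h2 h
    rw [Finset.mem_coe, mem_signed] at h1 h2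
    simp only at h
    subst h
    rw [h1.2, h2.2]

open Classical in
/-- The clauses whose literals are all true under `σ` are satisfied by `σ`; this bounds below the
number of clauses away from `x` and `y` that can be added without destroying the solution `σ`. -/
lemma exists_extension {k M : ℕ} (hk : 1 ≤ k) (x y : Fin n) {H : Finset (Clause n)}
    (hH : H.card ≤ M) {σ : Fin n → Bool} (hσ : SatBy H σ) :
    ∃ E : Finset (Clause n), (n - 2).choose k - M ≤ E.card ∧
      ∀ c ∈ E, c ∉ H ∧ c ∈ kClauses n k ∧ c ∉ touching k x y ∧ SatBy (insert c H) σ := by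
  set J := ((Finset.univ.erase x).erase y).powersetCard k with hJ
  have hJc : (n - 2).choose k ≤ J.card := by
    rw [hJ, Finset.card_powersetCard]
    refine Nat.choose_le_choose k ?_
    have h1 := Finset.pred_card_le_card_erase (s := (Finset.univ : Finset (Fin n)).erase x) (a := y)
    rw [Finset.card_erase_of_mem (Finset.mem_univ x), Finset.card_univ, Fintype.card_fin] at h1
    omega
  refine ⟨J.image (signed σ) \ H, ?_, ?_⟩
  · have h1 := Finset.le_card_sdiff H (J.image (signed σ))
    rw [Finset.card_image_of_injective _ (signed_injective σ)] at h1
    omega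
  · intro c hc
    obtain ⟨h1, h2⟩ := Finset.mem_sdiff.1 hc
    obtain ⟨I, hI, rfl⟩ := Finset.mem_image.1 h1
    obtain ⟨hI1, hI2⟩ := Finset.mem_powersetCard.1 hI
    refine ⟨h2, hI2 ▸ signed_mem_kClauses σ I, ?_, ?_⟩
    · intro ht
      obtain ⟨-, v, h3 | h3⟩ := Finset.mem_filter.1 ht
      · have := hI1 (mem_signed.1 h3).1
        simp at this
      · have := hI1 (mem_signed.1 h3).1
        simp at this
    · intro a ha
      rcases Finset.mem_insert.1 ha with rfl | ha
      · obtain ⟨i, hi⟩ : I.Nonempty := Finset.card_pos.1 (by omega)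
        exact ⟨i, mem_signed.2 ⟨hi, rfl⟩⟩
      · exact hσ a ha

/-! ### Counting satisfiable formulas -/

lemma mem_satFormulas {k m : ℕ} {F : Finset (Clause n)} :
    F ∈ satFormulas n k m ↔ F ⊆ kClauses n k ∧ F.card = m ∧ (sols F).Nonempty := by
  simp only [satFormulas, Finset.mem_filter, Finset.mem_powersetCard, satisfiable_ofClauses,
    and_assoc]
  refine and_congr_right fun _ => and_congr_right fun _ => ?_
  simp [Finset.Nonempty, mem_sols]

lemma satFormulas_of_subset {k m M : ℕ} {F H : Finset (Clause n)} (hF : F ∈ satFormulas n k m)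
    (hH : H ⊆ F) (hc : H.card = M) : H ∈ satFormulas n k M := by
  rw [mem_satFormulas] at hF ⊢
  exact ⟨hH.trans hF.1, hc, hF.2.2.mono (sols_anti hH)⟩

lemma card_satFormulas_succ_le (k M : ℕ) :
    (satFormulas n k (M + 1)).card * (M + 1) ≤ (satFormulas n k M).card * (2 * n) ^ k := by
  classical
  refine (card_mul_le_of_erase (ℬ := satFormulas n k M) (D := kClauses n k) ?_ ?_).trans
    (Nat.mul_le_mul_left _ (card_kClauses_le k))
  · intro F hF
    rw [mem_satFormulas] at hF
    rw [Finset.inter_eq_left.2 hF.1, hF.2.1]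
  · intro F hF c hc
    refine satFormulas_of_subset hF (Finset.erase_subset _ _) ?_
    rw [Finset.card_erase_of_mem (Finset.mem_inter.1 hc).1, (mem_satFormulas.1 hF).2.1]
    simp

open Classical in
/-- The satisfiable formulas with `M` clauses exactly `d` of which contain `x` or `y`. -/
def satWithDegree (k M : ℕ) (x y : Fin n) (d : ℕ) : Finset (Finset (Clause n)) :=
  (satFormulas n k M).filter fun F => (F ∩ touching k x y).card = d

lemma insert_mem_satWithDegree {k M d : ℕ} {x y : Fin n} {H : Finset (Clause n)} {c : Clause n}
    {σ : Fin n → Bool} (hH : H ∈ satWithDegree k M x y d) (hcH : c ∉ H) (hck : c ∈ kClauses n k)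
    (hct : c ∉ touching k x y) (hσ : SatBy (insert c H) σ) :
    insert c H ∈ satWithDegree k (M + 1) x y d := by
  classical
  obtain ⟨h1, h2⟩ := Finset.mem_filter.1 hH
  rw [mem_satFormulas] at h1
  refine Finset.mem_filter.2 ⟨mem_satFormulas.2 ⟨?_, ?_, σ, mem_sols.2 hσ⟩, ?_⟩
  · exact Finset.insert_subset hck h1.1
  · rw [Finset.card_insert_of_notMem hcH, h1.2.1]
  · rw [Finset.insert_inter_of_notMem hct, h2]

lemma card_satWithDegree_mul_le {k M : ℕ} (hk : 1 ≤ k) (x y : Fin n) (d : ℕ) :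
    (satWithDegree k M x y d).card * ((n - 2).choose k - M) ≤
      (satWithDegree k (M + 1) x y d).card * (M + 1) := by
  classical
  refine card_mul_le_of_insert ?_ ?_
  · intro H hH
    have h1 := mem_satFormulas.1 (Finset.mem_filter.1 hH).1
    obtain ⟨σ, hσ⟩ := h1.2.2
    obtain ⟨E, hE, hE'⟩ := exists_extension hk x y h1.2.1.le (mem_sols.1 hσ)
    refine ⟨E, hE, fun c hc => ?_⟩
    obtain ⟨h3, h4, h5, h6⟩ := hE' c hc
    exact ⟨h3, insert_mem_satWithDegree hH h3 h4 h5 h6⟩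
  · intro F hF
    exact (mem_satFormulas.1 (Finset.mem_filter.1 hF).1).2.1.le

lemma card_satWithDegree_succ_mul_le (k M : ℕ) (x y : Fin n) (d : ℕ) :
    (satWithDegree k (M + 1) x y (d + 1)).card * (d + 1) ≤
      (satWithDegree k M x y d).card * (4 * (2 * n) ^ (k - 1)) := by
  classical
  refine (card_mul_le_of_erase (ℬ := satWithDegree k M x y d) (D := touching k x y) ?_ ?_).trans
    (Nat.mul_le_mul_left _ (card_touching_le k x y))
  · intro F hF
    exact (Finset.mem_filter.1 hF).2.ge
  · intro F hF c hc
    obtain ⟨h1, h2⟩ := Finset.mem_filter.1 hF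
    refine Finset.mem_filter.2 ⟨satFormulas_of_subset h1 (Finset.erase_subset _ _) ?_, ?_⟩
    · rw [Finset.card_erase_of_mem (Finset.mem_inter.1 hc).1, (mem_satFormulas.1 h1).2.1]
      simp
    · rw [Finset.erase_inter, Finset.card_erase_of_mem hc, h2]
      simp

lemma card_satFormulas_eq_sum (k M : ℕ) (x y : Fin n) :
    (satFormulas n k M).card = ∑ d ∈ Finset.range (M + 1), (satWithDegree k M x y d).card := by
  classical
  refine Finset.card_eq_sum_card_fiberwise fun F hF => ?_
  have h1 := (mem_satFormulas.1 (Finset.mem_coe.1 hF)).2.1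
  have := Finset.card_le_card (Finset.inter_subset_left (s₁ := F) (s₂ := touching k x y))
  simp only [Finset.coe_range, Set.mem_Iio]
  omega

lemma card_satFormulas_mul_le {k M : ℕ} (hk : 1 ≤ k) (hn : 0 < n) :
    (satFormulas n k M).card * ((n - 2).choose k - M) ≤
      (satFormulas n k (M + 1)).card * (M + 1) := by
  rw [card_satFormulas_eq_sum k M ⟨0, hn⟩ ⟨0, hn⟩,
    card_satFormulas_eq_sum k (M + 1) ⟨0, hn⟩ ⟨0, hn⟩, Finset.sum_mul, Finset.sum_mul]
  exact (Finset.sum_le_sum fun d _ => card_satWithDegree_mul_le hk _ _ d).trans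
    (Finset.sum_le_sum_of_subset (Finset.range_subset_range.2 (by omega)))

/-- The degree of the pair `x, y` in a random satisfiable formula has a distribution dominated by
that of a Poisson variable of bounded mean: each step of the recursion exchanges one clause that
contains `x` or `y` for one that contains neither. -/
lemma card_satWithDegree_le {k M : ℕ} (hk : 1 ≤ k) (x y : Fin n) {C : ℝ} (hC : 0 ≤ C)
    (he : ((M : ℝ) * (4 * (2 * n) ^ (k - 1)) ≤ C * ((n - 2).choose k - M : ℕ)))
    (hpos : 0 < (n - 2).choose k - M) (d : ℕ) :
    ((satWithDegree k M x y d).card : ℝ) ≤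
      C ^ d / (d.factorial : ℝ) * (satWithDegree k M x y 0).card := by
  induction d with
  | zero => simp
  | succ d ih =>
    rcases M with _ | M
    · have : satWithDegree k 0 x y (d + 1) = ∅ := by
        classical
        rw [satWithDegree, Finset.filter_eq_empty_iff]
        intro F hF
        have h1 := (mem_satFormulas.1 hF).2.1
        have := Finset.card_le_card (Finset.inter_subset_left (s₁ := F) (s₂ := touching k x y))
        omega
      rw [this]
      simp
      positivity
    · have h1 := card_satWithDegree_succ_mul_le k M x y d
      have h2 := card_satWithDegree_mul_le (M := M) hk x y d
      set e := (n - 2).choose k - (M + 1) with hedef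
      set t := 4 * (2 * n) ^ (k - 1) with ht
      have h2' : (satWithDegree k M x y d).card * e ≤
          (satWithDegree k (M + 1) x y d).card * (M + 1) :=
        (Nat.mul_le_mul_left _ (by omega)).trans h2
      have h1r : ((satWithDegree k (M + 1) x y (d + 1)).card : ℝ) * (d + 1) ≤
          (satWithDegree k M x y d).card * t := by exact_mod_cast h1
      have h2r : ((satWithDegree k M x y d).card : ℝ) * e ≤
          (satWithDegree k (M + 1) x y d).card * (M + 1) := by exact_mod_cast h2'
      have her : ((M : ℝ) + 1) * t ≤ C * e := by
        have : ((M + 1 : ℕ) : ℝ) * (4 * (2 * n) ^ (k - 1)) = ((M : ℝ) + 1) * t := by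
          rw [ht]; push_cast; ring
        rw [← this]; exact he
      have he0 : (0 : ℝ) < e := by exact_mod_cast hpos
      have hstep : ((satWithDegree k (M + 1) x y (d + 1)).card : ℝ) * (d + 1) ≤
          C * (satWithDegree k (M + 1) x y d).card := by
        refine le_of_mul_le_mul_right ?_ he0
        calc ((satWithDegree k (M + 1) x y (d + 1)).card : ℝ) * (d + 1) * e
            ≤ (satWithDegree k M x y d).card * t * e := by gcongr
          _ = (satWithDegree k M x y d).card * e * t := by ring
          _ ≤ (satWithDegree k (M + 1) x y d).card * (M + 1) * t := by gcongr
          _ = (satWithDegree k (M + 1) x y d).card * ((M + 1) * t) := by ring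
          _ ≤ (satWithDegree k (M + 1) x y d).card * (C * e) := by gcongr
          _ = _ := by ring
      have hd : (0 : ℝ) < d + 1 := by positivity
      rw [← le_div_iff₀ hd] at hstep
      refine hstep.trans ?_
      rw [Nat.factorial_succ, pow_succ, div_le_iff₀ hd]
      calc C * ((satWithDegree k (M + 1) x y d).card : ℝ)
          ≤ C * (C ^ d / (d.factorial : ℝ) * (satWithDegree k (M + 1) x y 0).card) := by gcongr
        _ = _ := by
          have : (d.factorial : ℝ) ≠ 0 := by positivity
          push_cast
          field_simp

/-- With probability bounded below, two given variables occur in no clause. -/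
lemma card_satFormulas_le_exp_mul {k M : ℕ} (hk : 1 ≤ k) (x y : Fin n) {C : ℝ} (hC : 0 ≤ C)
    (he : ((M : ℝ) * (4 * (2 * n) ^ (k - 1)) ≤ C * ((n - 2).choose k - M : ℕ)))
    (hpos : 0 < (n - 2).choose k - M) :
    ((satFormulas n k M).card : ℝ) ≤ Real.exp C * (satWithDegree k M x y 0).card := by
  rw [card_satFormulas_eq_sum k M x y, Nat.cast_sum]
  refine (Finset.sum_le_sum fun d _ => card_satWithDegree_le hk x y hC he hpos d).trans ?_
  rw [← Finset.sum_mul]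
  gcongr
  exact Real.sum_le_exp_of_nonneg hC _

/-- The expected number of members of a family of `j`-sets of clauses that are contained in a random
satisfiable formula: removing such a set from the formula leaves a satisfiable formula. -/
lemma sum_card_filter_subset_le {ι : Type*} (k M j : ℕ) (P : Finset ι) (g : ι → Finset (Clause n))
    (hg : ∀ p ∈ P, (g p).card = j) :
    ∑ F ∈ satFormulas n k (M + j), (P.filter fun p => g p ⊆ F).card ≤
      (satFormulas n k M).card * P.card := by
  classical
  rw [← Finset.card_sigma, ← Finset.card_product]
  refine Finset.card_le_card_of_injOn (fun q => (q.1 \ g q.2, q.2)) ?_ ?_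
  · rintro ⟨F, p⟩ hq
    simp only [Finset.coe_sigma, Set.mem_sigma_iff, Finset.mem_coe, Finset.mem_filter] at hq
    simp only [Finset.coe_product, Set.mem_prod, Finset.mem_coe]
    refine ⟨satFormulas_of_subset hq.1 Finset.sdiff_subset ?_, hq.2.1⟩
    rw [Finset.card_sdiff_of_subset hq.2.2, hg p hq.2.1, (mem_satFormulas.1 hq.1).2.1]
    simp
  · rintro ⟨F, p⟩ hq ⟨F', p'⟩ hq' heq
    simp only [Finset.coe_sigma, Set.mem_sigma_iff, Finset.mem_coe, Finset.mem_filter] at hq hq'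
    simp only [Prod.mk.injEq] at heq
    obtain ⟨h1, rfl⟩ := heq
    have : F = F' := by
      rw [← Finset.sdiff_union_of_subset hq.2.2, h1, Finset.sdiff_union_of_subset hq'.2.2]
    subst this
    rfl

/-! ### The expected number of double edges -/

lemma sum_le_sum_of_injOn {ι κ : Type*} {s : Finset ι} {t : Finset κ} {u : ι → ℝ} {v : κ → ℝ}
    (f : ι → κ) (hf : ∀ i ∈ s, f i ∈ t) (hinj : Set.InjOn f s) (huv : ∀ i ∈ s, u i ≤ v (f i))
    (hv : ∀ j ∈ t, 0 ≤ v j) : ∑ i ∈ s, u i ≤ ∑ j ∈ t, v j := by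
  classical
  calc ∑ i ∈ s, u i ≤ ∑ i ∈ s, v (f i) := Finset.sum_le_sum huv
    _ = ∑ j ∈ s.image f, v j := (Finset.sum_image hinj).symm
    _ ≤ ∑ j ∈ t, v j := Finset.sum_le_sum_of_subset_of_nonneg
        (Finset.image_subset_iff.2 hf) fun j hj _ => hv j hj

open Classical in
/-- The (ordered) pairs of clauses that form a double edge of `F` under `σ`. -/
def doubleEdges (F : Finset (Clause n)) (σ : Fin n → Bool) : Finset (Clause n × Clause n) :=
  Finset.univ.filter fun p => ∃ x y, DoubleEdge F σ x y p.1 p.2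

open Classical in
/-- The (ordered) pairs of clauses that form a double edge of `F` under `σ` on `x` and `y`. -/
def doubleEdgesAt (F : Finset (Clause n)) (σ : Fin n → Bool) (x y : Fin n) :
    Finset (Clause n × Clause n) :=
  Finset.univ.filter fun p => DoubleEdge F σ x y p.1 p.2

/-- A clause of a double edge determines the variables `x` and `y`: they are the only ones on which it
has a literal that is true under `σ`. -/
lemma DoubleEdge.eq_of_mem {F : Finset (Clause n)} {σ : Fin n → Bool} {x y x' y' : Fin n}
    {a b a' b' : Clause n} (h : DoubleEdge F σ x y a b) (h' : DoubleEdge F σ x' y' a' b')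
    (haa : a' = a ∨ a' = b) : x' = x ∧ y' = y := by
  have key : ∀ z, (z, σ z) ∈ a' → z = x ∨ z = y := by
    intro z hz
    have h1 : (z, σ z) = (x, σ x) ∨ (z, σ z) = (y, σ y) ∨ (z < x ∧ σ z = !σ z) := by
      rcases haa with rfl | rfl
      · exact h.rest_left _ hz
      · exact h.rest_right _ hz
    rcases h1 with h1 | h1 | h1
    · exact Or.inl (Prod.mk.inj h1).1
    · exact Or.inr (Prod.mk.inj h1).1
    · simp at h1
  have h1 := h.lt
  have h2 := h'.lt
  rcases key _ h'.fst_left with rfl | rfl <;> rcases key _ h'.snd_left with rfl | rfl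
  · exact absurd h2 (lt_irrefl _)
  · exact ⟨rfl, rfl⟩
  · exact absurd h2 h1.asymm
  · exact absurd h2 (lt_irrefl _)

lemma sum_card_doubleEdgesAt_le (F : Finset (Clause n)) (σ : Fin n → Bool) (X Y : Finset (Fin n)) :
    ∑ q ∈ X ×ˢ Y, (doubleEdgesAt F σ q.1 q.2).card ≤ (doubleEdges F σ).card := by
  classical
  rw [← Finset.card_biUnion]
  · refine Finset.card_le_card fun p hp => ?_
    obtain ⟨q, -, hq⟩ := Finset.mem_biUnion.1 hp
    exact Finset.mem_filter.2 ⟨Finset.mem_univ _, q.1, q.2, (Finset.mem_filter.1 hq).2⟩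
  · intro q _ q' _ hne
    rw [Function.onFun, Finset.disjoint_left]
    intro p hp hp'
    have := DoubleEdge.eq_of_mem (Finset.mem_filter.1 hp).2 (Finset.mem_filter.1 hp').2 (Or.inl rfl)
    exact hne (Prod.ext this.1 this.2).symm

open Classical in
/-- The clauses that can take part in a double edge on `x` and `y` under `σ`: their literals on `x`
and `y` are true, and all others are false and belong to variables before `x`. -/
def doubleEdgeClauses (k : ℕ) (σ : Fin n → Bool) (x y : Fin n) : Finset (Clause n) :=
  ((Finset.Iio x).powersetCard (k - 2)).image fun J =>
    signed (fun i => if i < x then !σ i else σ i) (insert x (insert y J))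

lemma card_doubleEdgeClauses (k : ℕ) (σ : Fin n → Bool) {x y : Fin n} (hxy : x < y) :
    (doubleEdgeClauses k σ x y).card = x.val.choose (k - 2) := by
  classical
  rw [doubleEdgeClauses, Finset.card_image_of_injOn, Finset.card_powersetCard, Fin.card_Iio]
  intro J hJ J' hJ' h
  have h1 := signed_injective _ h
  rw [Finset.mem_coe, Finset.mem_powersetCard] at hJ hJ'
  have aux : ∀ I ⊆ Finset.Iio x, (insert x (insert y I)).filter (· < x) = I := by
    intro I hI
    ext i
    simp only [Finset.mem_filter, Finset.mem_insert]
    constructor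
    · rintro ⟨rfl | rfl | h, h2⟩
      · exact absurd h2 (lt_irrefl _)
      · exact absurd h2 hxy.asymm
      · exact h
    · exact fun h => ⟨Or.inr (Or.inr h), Finset.mem_Iio.1 (hI h)⟩
  rw [← aux J hJ.1, h1, aux J' hJ'.1]

lemma mem_doubleEdgeClauses {k : ℕ} (hk : 2 ≤ k) {σ : Fin n → Bool} {x y : Fin n} (hxy : x < y)
    {a : Clause n} (ha : a ∈ doubleEdgeClauses k σ x y) :
    a ∈ kClauses n k ∧ (x, σ x) ∈ a ∧ (y, σ y) ∈ a ∧
      ∀ l ∈ a, l = (x, σ x) ∨ l = (y, σ y) ∨ (l.1 < x ∧ l.2 = !σ l.1) := by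
  classical
  obtain ⟨J, hJ, rfl⟩ := Finset.mem_image.1 ha
  obtain ⟨hJ1, hJ2⟩ := Finset.mem_powersetCard.1 hJ
  have hxJ : x ∉ J := fun h => lt_irrefl _ (Finset.mem_Iio.1 (hJ1 h))
  have hyJ : y ∉ J := fun h => (Finset.mem_Iio.1 (hJ1 h)).asymm hxy
  refine ⟨?_, ?_, ?_, ?_⟩
  · have hc : (insert x (insert y J)).card = k := by
      rw [Finset.card_insert_of_notMem, Finset.card_insert_of_notMem hyJ, hJ2]
      · omega
      · simp [hxJ, hxy.ne]
    exact hc ▸ signed_mem_kClauses _ _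
  · exact mem_signed.2 ⟨by simp, by simp⟩
  · exact mem_signed.2 ⟨by simp, by simp [hxy.asymm]⟩
  · rintro ⟨i, v⟩ hl
    obtain ⟨h1, h2⟩ := mem_signed.1 hl
    rcases Finset.mem_insert.1 h1 with rfl | h1
    · left; simp [h2]
    · rcases Finset.mem_insert.1 h1 with rfl | h1
      · right; left; simp [h2, hxy.asymm]
      · have h3 := Finset.mem_Iio.1 (hJ1 h1)
        right; right
        exact ⟨h3, by simp [h2, h3]⟩

/-- Two clauses of `doubleEdgeClauses`, added to a formula without `x` and `y`, form a double edge,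
and the set of solutions can only shrink. -/
lemma doubleEdge_insert {k M : ℕ} (hk : 2 ≤ k) {x y : Fin n} (hxy : x < y)
    {H : Finset (Clause n)} (hH : H ∈ satWithDegree k M x y 0) {σ : Fin n → Bool}
    (hσ : σ ∈ sols H) {a b : Clause n} (ha : a ∈ doubleEdgeClauses k σ x y)
    (hb : b ∈ doubleEdgeClauses k σ x y) (hab : a ≠ b) :
    a ∉ H ∧ b ∉ H ∧ insert a (insert b H) ∈ satFormulas n k (M + 2) ∧
      σ ∈ sols (insert a (insert b H)) ∧ DoubleEdge (insert a (insert b H)) σ x y a b := by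
  classical
  obtain ⟨ha1, ha2, ha3, ha4⟩ := mem_doubleEdgeClauses hk hxy ha
  obtain ⟨hb1, hb2, hb3, hb4⟩ := mem_doubleEdgeClauses hk hxy hb
  obtain ⟨hH1, hH2⟩ := Finset.mem_filter.1 hH
  rw [mem_satFormulas] at hH1
  rw [Finset.card_eq_zero] at hH2
  have hiso : ∀ c ∈ H, ∀ v, ¬ ((x, v) ∈ c ∨ (y, v) ∈ c) := by
    intro c hc v hv
    have : c ∈ H ∩ touching k x y :=
      Finset.mem_inter.2 ⟨hc, Finset.mem_filter.2 ⟨hH1.1 hc, v, hv⟩⟩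
    rw [hH2] at this
    simp at this
  have haH : a ∉ H := fun h => hiso a h _ (Or.inl ha2)
  have hbH : b ∉ H := fun h => hiso b h _ (Or.inl hb2)
  have hsat : σ ∈ sols (insert a (insert b H)) := by
    rw [mem_sols] at hσ ⊢
    intro c hc
    simp only [Finset.mem_insert] at hc
    rcases hc with rfl | rfl | hc
    · exact ⟨x, ha2⟩
    · exact ⟨x, hb2⟩
    · exact hσ c hc
  refine ⟨haH, hbH, mem_satFormulas.2 ⟨?_, ?_, σ, hsat⟩, hsat, ?_⟩
  · exact Finset.insert_subset ha1 (Finset.insert_subset hb1 hH1.1)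
  · rw [Finset.card_insert_of_notMem, Finset.card_insert_of_notMem hbH, hH1.2.1]
    simp [haH, hab]
  · refine ⟨hxy, hab, by simp, by simp, ha2, ha3, hb2, hb3, ha4, hb4, fun c hc v hv => ?_⟩
    simp only [Finset.mem_insert] at hc
    rcases hc with rfl | rfl | hc
    · exact Or.inl rfl
    · exact Or.inr rfl
    · exact absurd hv (hiso c hc v)

lemma sum_sols_inv {F : Finset (Clause n)} (hF : (sols F).Nonempty) :
    ∑ _σ ∈ sols F, 1 / ((sols F).card : ℝ) = 1 := by
  have := hF.card_pos
  rw [Finset.sum_const, nsmul_eq_mul]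
  field_simp

/-- Formulas `H` in which `x` and `y` are isolated yield, together with their solutions `σ`, formulas
with a double edge on `x` and `y`; the weight `1 / |S(H)|` of `σ` does not decrease. -/
lemma satWithDegree_mul_le_sum {k M : ℕ} (hk : 2 ≤ k) {x y : Fin n} (hxy : x < y) :
    ((satWithDegree k M x y 0).card : ℝ) *
        (x.val.choose (k - 2) * x.val.choose (k - 2) - x.val.choose (k - 2) : ℕ) ≤
      ∑ F ∈ satFormulas n k (M + 2), ∑ σ ∈ sols F,
        1 / ((sols F).card : ℝ) * (doubleEdgesAt F σ x y).card := by
  classical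
  set S := (satWithDegree k M x y 0).sigma fun H => (sols H).sigma fun σ =>
    (doubleEdgeClauses k σ x y).offDiag with hS
  set T := (satFormulas n k (M + 2)).sigma fun F => (sols F).sigma fun σ =>
    doubleEdgesAt F σ x y with hT
  have h1 : ∑ q ∈ S, 1 / ((sols q.1).card : ℝ) = ((satWithDegree k M x y 0).card : ℝ) *
        (x.val.choose (k - 2) * x.val.choose (k - 2) - x.val.choose (k - 2) : ℕ) := by
    rw [hS, Finset.sum_sigma, ← nsmul_eq_mul, ← Finset.sum_const]
    refine Finset.sum_congr rfl fun H hH => ?_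
    rw [Finset.sum_sigma]
    simp only [Finset.sum_const, Finset.offDiag_card, card_doubleEdgeClauses k _ hxy, nsmul_eq_mul]
    have := (mem_satFormulas.1 (Finset.mem_filter.1 hH).1).2.2.card_pos
    field_simp
  have h2 : ∑ q ∈ T, 1 / ((sols q.1).card : ℝ) =
      ∑ F ∈ satFormulas n k (M + 2), ∑ σ ∈ sols F,
        1 / ((sols F).card : ℝ) * (doubleEdgesAt F σ x y).card := by
    rw [hT, Finset.sum_sigma]
    refine Finset.sum_congr rfl fun F _ => ?_
    rw [Finset.sum_sigma]
    refine Finset.sum_congr rfl fun σ _ => ?_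
    simp only [Finset.sum_const, nsmul_eq_mul]
    rw [mul_comm]
  rw [← h1, ← h2]
  have hmem : ∀ q ∈ S, q.1 ∈ satWithDegree k M x y 0 ∧ q.2.1 ∈ sols q.1 ∧
      q.2.2.1 ∈ doubleEdgeClauses k q.2.1 x y ∧ q.2.2.2 ∈ doubleEdgeClauses k q.2.1 x y ∧
      q.2.2.1 ≠ q.2.2.2 := by
    intro q hq
    simpa [hS, Finset.mem_sigma, Finset.mem_offDiag] using hq
  refine sum_le_sum_of_injOn
    (fun q => ⟨insert q.2.2.1 (insert q.2.2.2 q.1), q.2.1, q.2.2⟩) ?_ ?_ ?_ ?_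
  · rintro ⟨H, σ, a, b⟩ hq
    obtain ⟨q1, q2, q3, q4, q5⟩ := hmem _ hq
    obtain ⟨-, -, e1, e2, e3⟩ := doubleEdge_insert hk hxy q1 q2 q3 q4 q5
    exact Finset.mem_sigma.2 ⟨e1, Finset.mem_sigma.2 ⟨e2, Finset.mem_filter.2
      ⟨Finset.mem_univ _, e3⟩⟩⟩
  · rintro ⟨H, σ, a, b⟩ hq ⟨H', σ', a', b'⟩ hq' heq
    obtain ⟨q1, q2, q3, q4, q5⟩ := hmem _ hq
    obtain ⟨e1, e2, -⟩ := doubleEdge_insert hk hxy q1 q2 q3 q4 q5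
    obtain ⟨q1', q2', q3', q4', q5'⟩ := hmem _ hq'
    obtain ⟨e1', e2', -⟩ := doubleEdge_insert hk hxy q1' q2' q3' q4' q5'
    simp only [Sigma.mk.injEq, heq_eq_eq, Prod.mk.injEq] at heq e1 e2 e1' e2' q5 q5'
    obtain ⟨h1, rfl, rfl, rfl⟩ := heq
    have key : ∀ G : Finset (Clause n), a ∉ G → b ∉ G →
        ((insert a (insert b G)).erase a).erase b = G := by
      intro G haG hbG
      rw [Finset.erase_insert (by simp [haG, q5]), Finset.erase_insert hbG]
    have : H = H' := by rw [← key H e1 e2, h1, key H' e1' e2']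
    subst this
    rfl
  · rintro ⟨H, σ, a, b⟩ hq
    obtain ⟨q1, q2, q3, q4, q5⟩ := hmem _ hq
    obtain ⟨-, -, -, e2, -⟩ := doubleEdge_insert hk hxy q1 q2 q3 q4 q5
    refine one_div_le_one_div_of_le ?_ ?_
    · exact_mod_cast Finset.card_pos.2 ⟨σ, e2⟩
    · exact_mod_cast Finset.card_le_card
        (sols_anti ((Finset.subset_insert _ _).trans (Finset.subset_insert _ _)))
  · intro q _
    positivity

lemma sum_satWithDegree_mul_le {k M : ℕ} (hk : 2 ≤ k) {X Y : Finset (Fin n)}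
    (hXY : ∀ x ∈ X, ∀ y ∈ Y, x < y) :
    ∑ q ∈ X ×ˢ Y, ((satWithDegree k M q.1 q.2 0).card : ℝ) *
        (q.1.val.choose (k - 2) * q.1.val.choose (k - 2) - q.1.val.choose (k - 2) : ℕ) ≤
      ∑ F ∈ satFormulas n k (M + 2), ∑ σ ∈ sols F,
        1 / ((sols F).card : ℝ) * (doubleEdges F σ).card := by
  calc _ ≤ ∑ q ∈ X ×ˢ Y, ∑ F ∈ satFormulas n k (M + 2), ∑ σ ∈ sols F,
        1 / ((sols F).card : ℝ) * (doubleEdgesAt F σ q.1 q.2).card := by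
        refine Finset.sum_le_sum fun q hq => satWithDegree_mul_le_sum hk ?_
        obtain ⟨h1, h2⟩ := Finset.mem_product.1 hq
        exact hXY _ h1 _ h2
    _ = ∑ F ∈ satFormulas n k (M + 2), ∑ σ ∈ sols F, ∑ q ∈ X ×ˢ Y,
        1 / ((sols F).card : ℝ) * (doubleEdgesAt F σ q.1 q.2).card := by
        rw [Finset.sum_comm]
        exact Finset.sum_congr rfl fun F _ => Finset.sum_comm
    _ ≤ _ := by
        refine Finset.sum_le_sum fun F _ => Finset.sum_le_sum fun σ _ => ?_
        rw [← Finset.mul_sum]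
        gcongr
        exact_mod_cast sum_card_doubleEdgesAt_le F σ X Y

/-! ### The second moment of the number of double edges -/

open Classical in
/-- Pairs of disjoint elements of `sharingPairs`. -/
def disjointSharingPairs (n k : ℕ) : Finset ((Clause n × Clause n) × (Clause n × Clause n)) :=
  (sharingPairs n k ×ˢ sharingPairs n k).filter fun q =>
    Disjoint ({q.1.1, q.1.2} : Finset (Clause n)) {q.2.1, q.2.2}

open Classical in
/-- Two double edges either consist of the same two clauses or have no clause in common. -/
lemma sq_card_doubleEdges_le {k : ℕ} {F : Finset (Clause n)} (hF : F ⊆ kClauses n k)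
    (σ : Fin n → Bool) :
    (doubleEdges F σ).card ^ 2 ≤
      2 * ((sharingPairs n k).filter fun p => {p.1, p.2} ⊆ F).card +
        ((disjointSharingPairs n k).filter fun q =>
          ({q.1.1, q.1.2} : Finset (Clause n)) ∪ {q.2.1, q.2.2} ⊆ F).card := by
  set Q := (sharingPairs n k).filter fun p => ({p.1, p.2} : Finset (Clause n)) ⊆ F with hQ
  set R := (disjointSharingPairs n k).filter fun q =>
          ({q.1.1, q.1.2} : Finset (Clause n)) ∪ {q.2.1, q.2.2} ⊆ F with hR
  have hmemQ : ∀ p ∈ doubleEdges F σ, p ∈ Q := by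
    rintro ⟨a, b⟩ hp
    obtain ⟨-, x, y, h⟩ := Finset.mem_filter.1 hp
    refine Finset.mem_filter.2 ⟨Finset.mem_filter.2 ⟨Finset.mem_product.2
      ⟨hF h.mem_left, hF h.mem_right⟩, h.ne, (x, σ x), (y, σ y), ?_, ?_, ?_⟩, ?_⟩
    · exact fun he => h.lt.ne (Prod.mk.inj he).1
    · simp [Finset.insert_subset_iff, h.fst_left, h.snd_left]
    · simp [Finset.insert_subset_iff, h.fst_right, h.snd_right]
    · have h1 := h.mem_left
      have h2 := h.mem_right
      simp only at h1 h2
      simp [Finset.insert_subset_iff, h1, h2]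
  have hsub : doubleEdges F σ ×ˢ doubleEdges F σ ⊆
      (Q.image fun p => (p, p)) ∪ (Q.image fun p => (p, p.swap)) ∪ R := by
    rintro ⟨⟨a, b⟩, ⟨a', b'⟩⟩ hq
    obtain ⟨hp, hp'⟩ := Finset.mem_product.1 hq
    have hQp := hmemQ _ hp
    have hQp' := hmemQ _ hp'
    obtain ⟨-, x, y, h⟩ := Finset.mem_filter.1 hp
    obtain ⟨-, x', y', h'⟩ := Finset.mem_filter.1 hp'
    simp only at h h'
    have hcases : (a' = a ∨ a' = b) ∧ (b' = a ∨ b' = b) ∨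
        ¬ (a' = a ∨ a' = b) ∧ ¬ (b' = a ∨ b' = b) := by
      by_cases h1 : a' = a ∨ a' = b
      · obtain ⟨rfl, rfl⟩ := h.eq_of_mem h' h1
        exact Or.inl ⟨h1, h.only b' h'.mem_right _ (Or.inl h'.fst_right)⟩
      · refine Or.inr ⟨h1, fun h2 => h1 ?_⟩
        obtain ⟨rfl, rfl⟩ := h.eq_of_mem h'.symm h2
        exact h.only a' h'.mem_left _ (Or.inl h'.fst_left)
    have hne' : a' ≠ b' := h'.ne
    rcases hcases with ⟨h1, h2⟩ | ⟨h1, h2⟩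
    · refine Finset.mem_union_left _ ?_
      rcases h1 with rfl | rfl <;> rcases h2 with rfl | rfl
      · exact absurd rfl hne'
      · exact Finset.mem_union_left _ (Finset.mem_image.2 ⟨_, hQp, rfl⟩)
      · exact Finset.mem_union_right _ (Finset.mem_image.2 ⟨_, hQp, rfl⟩)
      · exact absurd rfl hne'
    · refine Finset.mem_union_right _ (Finset.mem_filter.2 ⟨Finset.mem_filter.2
        ⟨Finset.mem_product.2 ⟨(Finset.mem_filter.1 hQp).1, (Finset.mem_filter.1 hQp').1⟩, ?_⟩, ?_⟩)
      · rw [Finset.disjoint_right]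
        intro c hc hc'
        simp only [Finset.mem_insert, Finset.mem_singleton] at hc hc'
        rcases hc with rfl | rfl
        · exact h1 hc'
        · exact h2 hc'
      · exact Finset.union_subset (Finset.mem_filter.1 hQp).2 (Finset.mem_filter.1 hQp').2
  calc (doubleEdges F σ).card ^ 2 = (doubleEdges F σ ×ˢ doubleEdges F σ).card := by
        rw [Finset.card_product, sq]
    _ ≤ _ := Finset.card_le_card hsub
    _ ≤ (Q.image fun p => (p, p)).card + (Q.image fun p => (p, p.swap)).card + R.card :=
        (Finset.card_union_le _ _).trans (Nat.add_le_add_right (Finset.card_union_le _ _) _)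
    _ ≤ Q.card + Q.card + R.card := by
        gcongr <;> exact Finset.card_image_le
    _ = _ := by ring

/-- A bound on the second moment of the number of double edges in terms of the numbers of
satisfiable formulas with two and with four clauses fewer. -/
lemma sum_sq_card_doubleEdges_le (k M : ℕ) :
    ∑ F ∈ satFormulas n k (M + 4), ∑ σ ∈ sols F,
        1 / ((sols F).card : ℝ) * ((doubleEdges F σ).card : ℝ) ^ 2 ≤
      ((2 * ((satFormulas n k (M + 2)).card * (sharingPairs n k).card) +
        (satFormulas n k M).card * (sharingPairs n k).card ^ 2 : ℕ) : ℝ) := by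
  classical
  have h2 : ∀ p ∈ sharingPairs n k, ({p.1, p.2} : Finset (Clause n)).card = 2 := fun p hp =>
    Finset.card_pair (Finset.mem_filter.1 hp).2.1
  have h4 : ∀ q ∈ disjointSharingPairs n k,
      (({q.1.1, q.1.2} : Finset (Clause n)) ∪ {q.2.1, q.2.2}).card = 4 := by
    intro q hq
    obtain ⟨hq1, hq2⟩ := Finset.mem_filter.1 hq
    rw [Finset.mem_product] at hq1
    rw [Finset.card_union_of_disjoint hq2, h2 _ hq1.1, h2 _ hq1.2]
  have e2 := sum_card_filter_subset_le k (M + 2) 2 (sharingPairs n k)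
    (fun p => ({p.1, p.2} : Finset (Clause n))) h2
  have e4 := sum_card_filter_subset_le k M 4 (disjointSharingPairs n k)
    (fun q => ({q.1.1, q.1.2} : Finset (Clause n)) ∪ {q.2.1, q.2.2}) h4
  have e5 : (disjointSharingPairs n k).card ≤ (sharingPairs n k).card ^ 2 := by
    refine (Finset.card_filter_le _ _).trans_eq ?_
    rw [Finset.card_product, sq]
  have e6 := Nat.mul_le_mul_left (satFormulas n k M).card e5
  have hle : ∀ F ∈ satFormulas n k (M + 4), ∑ σ ∈ sols F,
        1 / ((sols F).card : ℝ) * ((doubleEdges F σ).card : ℝ) ^ 2 ≤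
      ((2 * ((sharingPairs n k).filter fun p => ({p.1, p.2} : Finset (Clause n)) ⊆ F).card +
        ((disjointSharingPairs n k).filter fun q =>
          ({q.1.1, q.1.2} : Finset (Clause n)) ∪ {q.2.1, q.2.2} ⊆ F).card : ℕ) : ℝ) := by
    intro F hF
    rw [mem_satFormulas] at hF
    have hN := sq_card_doubleEdges_le hF.1
    generalize 2 * ((sharingPairs n k).filter fun p => ({p.1, p.2} : Finset (Clause n)) ⊆ F).card +
      ((disjointSharingPairs n k).filter fun q =>
        ({q.1.1, q.1.2} : Finset (Clause n)) ∪ {q.2.1, q.2.2} ⊆ F).card = N at hN ⊢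
    calc _ ≤ ∑ σ ∈ sols F, 1 / ((sols F).card : ℝ) * (N : ℝ) := by
          refine Finset.sum_le_sum fun σ _ => ?_
          gcongr
          exact_mod_cast hN σ
      _ = N := by rw [← Finset.sum_mul, sum_sols_inv hF.2.2, one_mul]
  refine (Finset.sum_le_sum hle).trans ?_
  rw [← Nat.cast_sum, Finset.sum_add_distrib, ← Finset.mul_sum]
  exact Nat.cast_le.2 (Nat.add_le_add (Nat.mul_le_mul_left 2 e2) (e4.trans e6))

/-! ### Double edges occur with probability bounded below -/

open Classical in
/-- The second moment method: the number of double edges is positive with probability at least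
`c ^ 2 / B` if its mean is at least `c` and its second moment is at most `B`. -/
lemma second_moment {k m : ℕ} {c B : ℝ} (hc : 0 < c) (hB : 0 < B)
    (h1 : c * (satFormulas n k m).card ≤ ∑ F ∈ satFormulas n k m, ∑ σ ∈ sols F,
        1 / ((sols F).card : ℝ) * (doubleEdges F σ).card)
    (h2 : ∑ F ∈ satFormulas n k m, ∑ σ ∈ sols F,
        1 / ((sols F).card : ℝ) * ((doubleEdges F σ).card : ℝ) ^ 2 ≤
          B * (satFormulas n k m).card) :
    c ^ 2 / B * (satFormulas n k m).card ≤ ∑ F ∈ satFormulas n k m, ∑ σ ∈ sols F,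
        1 / ((sols F).card : ℝ) * (if (doubleEdges F σ).Nonempty then 1 else 0) := by
  set W := ∑ F ∈ satFormulas n k m, ∑ σ ∈ sols F,
        1 / ((sols F).card : ℝ) * ((doubleEdges F σ).card : ℝ) with hW
  set W2 := ∑ F ∈ satFormulas n k m, ∑ σ ∈ sols F,
        1 / ((sols F).card : ℝ) * ((doubleEdges F σ).card : ℝ) ^ 2 with hW2
  set P := ∑ F ∈ satFormulas n k m, ∑ σ ∈ sols F,
        1 / ((sols F).card : ℝ) * (if (doubleEdges F σ).Nonempty then (1 : ℝ) else 0) with hP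
  set s : ℝ := ((satFormulas n k m).card : ℝ) with hs
  -- Pointwise `Z ≤ A 1_{Z > 0} + Z² / (4 A)` by the AM-GM inequality; `A = B / (2 c)` is optimal.
  have key : W ≤ B / (2 * c) * P + c / (2 * B) * W2 := by
    rw [hW, hP, hW2, Finset.mul_sum, Finset.mul_sum, ← Finset.sum_add_distrib]
    refine Finset.sum_le_sum fun F _ => ?_
    rw [Finset.mul_sum, Finset.mul_sum, ← Finset.sum_add_distrib]
    refine Finset.sum_le_sum fun σ _ => ?_
    have hz : ((doubleEdges F σ).card : ℝ) ≤
        B / (2 * c) * (if (doubleEdges F σ).Nonempty then 1 else 0) +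
          c / (2 * B) * ((doubleEdges F σ).card : ℝ) ^ 2 := by
      split_ifs with h
      · have := sq_nonneg (B - c * ((doubleEdges F σ).card : ℝ))
        rw [div_mul_eq_mul_div, div_mul_eq_mul_div, div_add_div _ _ (by positivity) (by positivity),
          le_div_iff₀ (by positivity)]
        nlinarith
      · rw [Finset.not_nonempty_iff_eq_empty] at h
        simp [h]
    have hw : (0 : ℝ) ≤ 1 / ((sols F).card : ℝ) := by positivity
    calc _ ≤ 1 / ((sols F).card : ℝ) * _ := mul_le_mul_of_nonneg_left hz hw
      _ = _ := by ring
  have h3 : c * s ≤ B / (2 * c) * P + c / 2 * s := by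
    have h4 : c / (2 * B) * W2 ≤ c / (2 * B) * (B * s) := by gcongr
    have h5 : c / (2 * B) * (B * s) = c / 2 * s := by field_simp
    linarith
  have h6 : c / 2 * s ≤ B / (2 * c) * P := by linarith
  have h7 : c ^ 2 / B * s = 2 * c / B * (c / 2 * s) := by field_simp
  have h8 : P = 2 * c / B * (B / (2 * c) * P) := by field_simp
  rw [h7, h8]
  gcongr

lemma pow_div_le_choose {N j : ℕ} {a : ℝ} (ha : 0 ≤ a) (h : a + j ≤ N + 1) :
    a ^ j / j.factorial ≤ (N.choose j : ℝ) := by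
  have h2 : a ≤ ((N + 1 - j : ℕ) : ℝ) := by
    have hj : j ≤ N + 1 := by
      have : (j : ℝ) ≤ ((N + 1 : ℕ) : ℝ) := by push_cast; linarith
      exact_mod_cast this
    rw [Nat.cast_sub hj]
    push_cast
    linarith
  refine (div_le_div_of_nonneg_right (pow_le_pow_left₀ ha h2 j) (by positivity)).trans ?_
  exact Nat.pow_le_choose j N

lemma card_satFormulas_succ_mul_le (k M : ℕ) {a : ℝ} (ha : a ≤ (M : ℝ) + 1) :
    ((satFormulas n k (M + 1)).card : ℝ) * a ≤ (satFormulas n k M).card * (2 * n : ℝ) ^ k := by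
  have h : ((satFormulas n k (M + 1)).card : ℝ) * ((M : ℝ) + 1) ≤
      (satFormulas n k M).card * (2 * n : ℝ) ^ k := by
    exact_mod_cast card_satFormulas_succ_le (n := n) k M
  exact (mul_le_mul_of_nonneg_left ha (Nat.cast_nonneg _)).trans h

lemma card_satFormulas_mul_sq_le (k M : ℕ) {a : ℝ} (ha0 : 0 ≤ a) (ha : a ≤ (M : ℝ) + 1) :
    ((satFormulas n k (M + 2)).card : ℝ) * a ^ 2 ≤
      (satFormulas n k M).card * ((2 * n : ℝ) ^ k) ^ 2 := by
  have e1 := card_satFormulas_succ_mul_le (n := n) k (M + 1) (a := a) (by push_cast; linarith)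
  have e2 := card_satFormulas_succ_mul_le (n := n) k M ha
  calc ((satFormulas n k (M + 2)).card : ℝ) * a ^ 2
      = (satFormulas n k (M + 2)).card * a * a := by ring
    _ ≤ (satFormulas n k (M + 1)).card * (2 * n : ℝ) ^ k * a := by gcongr
    _ = (satFormulas n k (M + 1)).card * a * (2 * n : ℝ) ^ k := by ring
    _ ≤ (satFormulas n k M).card * (2 * n : ℝ) ^ k * (2 * n : ℝ) ^ k := by gcongr
    _ = _ := by ring

/-- The mean number of double edges is bounded below in a formula with `M + 4 ≥ c₁ n` clauses. Here
`α` measures the supply of clauses that can be added, `C` bounds the mean of the Poisson variable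
that dominates the degree of a pair of variables, and `γ` measures the number of clauses that can
take part in a double edge on `x, y`; `x` ranges over the second quarter of the variables and `y`
over the second half, so that enough variables precede `x`. -/
lemma first_moment_lower {k M : ℕ} (hk : 3 ≤ k) {α c₁ C γ : ℝ} (hα : 0 < α) (hc₁ : 0 < c₁)
    (hC : 0 ≤ C) (hγ : 0 < γ) (hn : 4 ≤ n)
    (hm1 : c₁ * n ≤ ((M + 4 : ℕ) : ℝ))
    (hα' : α * (n : ℝ) ^ k ≤ ((n - 2).choose k - (M + 2) : ℕ))
    (hC' : ((M + 2 : ℕ) : ℝ) * (4 * (2 * n) ^ (k - 1)) ≤ C * ((n - 2).choose k - (M + 2) : ℕ))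
    (hγ' : ∀ x : ℕ, n / 4 ≤ x → 2 ≤ x.choose (k - 2) ∧
      γ * (n : ℝ) ^ (k - 2) ≤ (x.choose (k - 2) : ℝ)) :
    γ ^ 2 * Real.exp (-C) * c₁ ^ 2 / (256 * 4 ^ k) * (satFormulas n k (M + 4)).card ≤
      ∑ F ∈ satFormulas n k (M + 4), ∑ σ ∈ sols F,
        1 / ((sols F).card : ℝ) * (doubleEdges F σ).card := by
  have hn0 : (0 : ℝ) < n := by exact_mod_cast (by omega : 0 < n)
  have hpos : 0 < (n - 2).choose k - (M + 2) := by
    have : (0 : ℝ) < ((n - 2).choose k - (M + 2) : ℕ) := lt_of_lt_of_le (by positivity) hα'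
    exact_mod_cast this
  set p : Fin n := ⟨n / 4, by omega⟩ with hp
  set q : Fin n := ⟨n / 2, by omega⟩ with hq
  have hW := sum_satWithDegree_mul_le (n := n) (M := M + 2) (by omega : 2 ≤ k)
    (X := Finset.Ico p q) (Y := Finset.Ici q)
    (fun x hx y hy => (Finset.mem_Ico.1 hx).2.trans_le (Finset.mem_Ici.1 hy))
  refine le_trans ?_ hW
  set s2 : ℝ := ((satFormulas n k (M + 2)).card : ℝ) with hs2
  set s4 : ℝ := ((satFormulas n k (M + 4)).card : ℝ) with hs4
  have hterm : ∀ r ∈ Finset.Ico p q ×ˢ Finset.Ici q,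
      Real.exp (-C) * s2 * ((γ * (n : ℝ) ^ (k - 2)) ^ 2 / 2) ≤
      ((satWithDegree k (M + 2) r.1 r.2 0).card : ℝ) *
        (r.1.val.choose (k - 2) * r.1.val.choose (k - 2) - r.1.val.choose (k - 2) : ℕ) := by
    intro r hr
    have hr1 : n / 4 ≤ r.1.val := (Finset.mem_Ico.1 (Finset.mem_product.1 hr).1).1
    obtain ⟨ht2, ht⟩ := hγ' _ hr1
    generalize r.1.val.choose (k - 2) = t at ht ht2 ⊢
    have h1 := card_satFormulas_le_exp_mul (M := M + 2) (by omega : 1 ≤ k) r.1 r.2 hC hC' hpos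
    have h2 : Real.exp (-C) * s2 ≤ ((satWithDegree k (M + 2) r.1 r.2 0).card : ℝ) := by
      rw [Real.exp_neg, inv_mul_le_iff₀ (Real.exp_pos C)]
      exact h1
    have ht2r : (2 : ℝ) ≤ t := by exact_mod_cast ht2
    have h3 : (γ * (n : ℝ) ^ (k - 2)) ^ 2 / 2 ≤ ((t * t - t : ℕ) : ℝ) := by
      rw [Nat.cast_sub (Nat.le_mul_self t)]
      push_cast
      have : (γ * (n : ℝ) ^ (k - 2)) ^ 2 ≤ (t : ℝ) ^ 2 := pow_le_pow_left₀ (by positivity) ht 2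
      nlinarith
    exact mul_le_mul h2 h3 (by positivity) (by positivity)
  refine le_trans ?_ (Finset.card_nsmul_le_sum _ _ _ hterm)
  rw [nsmul_eq_mul, Finset.card_product, Fin.card_Ico, Fin.card_Ici]
  have hX : (n : ℝ) / 8 ≤ ((n / 2 - n / 4 : ℕ) : ℝ) := by
    have : n ≤ 8 * (n / 2 - n / 4) := by omega
    have : (n : ℝ) ≤ 8 * ((n / 2 - n / 4 : ℕ) : ℝ) := by exact_mod_cast this
    linarith
  have hY : (n : ℝ) / 2 ≤ ((n - n / 2 : ℕ) : ℝ) := by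
    have : n ≤ 2 * (n - n / 2) := by omega
    have : (n : ℝ) ≤ 2 * ((n - n / 2 : ℕ) : ℝ) := by exact_mod_cast this
    linarith
  have hXY : (n : ℝ) / 8 * (n / 2) ≤ (((n / 2 - n / 4) * (n - n / 2) : ℕ) : ℝ) := by
    push_cast
    exact mul_le_mul hX hY (by positivity) (by positivity)
  have hs : s4 * (c₁ * n / 2) ^ 2 ≤ s2 * ((2 * n : ℝ) ^ k) ^ 2 := by
    refine card_satFormulas_mul_sq_le k (M + 2) (by positivity) ?_
    push_cast at hm1 ⊢
    have : (0 : ℝ) ≤ M := by positivity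
    linarith
  have hE : 0 ≤ Real.exp (-C) * s2 * ((γ * (n : ℝ) ^ (k - 2)) ^ 2 / 2) := by positivity
  have hnk : (n : ℝ) ^ k = (n : ℝ) ^ (k - 2) * (n : ℝ) ^ 2 := by
    rw [← pow_add]; congr 1; omega
  have h4k : (2 : ℝ) ^ k * 2 ^ k = 4 ^ k := by rw [← mul_pow]; norm_num
  calc γ ^ 2 * Real.exp (-C) * c₁ ^ 2 / (256 * 4 ^ k) * s4
      = γ ^ 2 * Real.exp (-C) / (64 * 4 ^ k * n ^ 2) * (s4 * (c₁ * n / 2) ^ 2) := by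
        field_simp
        ring
    _ ≤ γ ^ 2 * Real.exp (-C) / (64 * 4 ^ k * n ^ 2) * (s2 * ((2 * n : ℝ) ^ k) ^ 2) := by gcongr
    _ = γ ^ 2 * Real.exp (-C) / (64 * n ^ 2) * s2 * ((n : ℝ) ^ k) ^ 2 := by
        rw [mul_pow, ← h4k]
        field_simp
    _ = γ ^ 2 * Real.exp (-C) / (64 * n ^ 2) * s2 * ((n : ℝ) ^ (k - 2) * (n : ℝ) ^ 2) ^ 2 := by
        rw [hnk]
    _ ≤ (n : ℝ) / 8 * (n / 2) *
          (Real.exp (-C) * s2 * ((γ * (n : ℝ) ^ (k - 2)) ^ 2 / 2)) := by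
        have : γ ^ 2 * Real.exp (-C) / (64 * (n : ℝ) ^ 2) * s2 *
            ((n : ℝ) ^ (k - 2) * (n : ℝ) ^ 2) ^ 2 = 1 / 2 * ((n : ℝ) / 8 * (n / 2) *
          (Real.exp (-C) * s2 * ((γ * (n : ℝ) ^ (k - 2)) ^ 2 / 2))) := by
          field_simp
          ring
        rw [this]
        have : (0 : ℝ) ≤ (n : ℝ) / 8 * (n / 2) *
          (Real.exp (-C) * s2 * ((γ * (n : ℝ) ^ (k - 2)) ^ 2 / 2)) :=
          mul_nonneg (by positivity) hE
        linarith
    _ ≤ _ := mul_le_mul_of_nonneg_right hXY hE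

/-- The second moment of the number of double edges is bounded. -/
lemma second_moment_upper {k M : ℕ} (hk : 3 ≤ k) {α c₂ : ℝ} (hα : 0 < α) (hc₂ : 0 < c₂)
    (hn : 0 < n) (hm2 : ((M + 4 : ℕ) : ℝ) ≤ c₂ * n)
    (hα' : α * (n : ℝ) ^ k ≤ ((n - 2).choose k - (M + 4) : ℕ)) :
    ∑ F ∈ satFormulas n k (M + 4), ∑ σ ∈ sols F,
        1 / ((sols F).card : ℝ) * ((doubleEdges F σ).card : ℝ) ^ 2 ≤
      (2 * (c₂ ^ 2 * 4 ^ (k - 1) / α ^ 2) + (c₂ ^ 2 * 4 ^ (k - 1) / α ^ 2) ^ 2) *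
        (satFormulas n k (M + 4)).card := by
  have hn0 : (0 : ℝ) < n := by exact_mod_cast hn
  refine (sum_sq_card_doubleEdges_le k M).trans ?_
  set D := c₂ ^ 2 * 4 ^ (k - 1) / α ^ 2 with hD
  set β := α * (n : ℝ) ^ k with hβ
  have hβ0 : 0 < β := by positivity
  have step : ∀ j, j < 4 → ((satFormulas n k (M + j)).card : ℝ) * β ≤
      (satFormulas n k (M + (j + 1))).card * (c₂ * n) := by
    intro j hj
    have h1 := card_satFormulas_mul_le (n := n) (M := M + j) (by omega : 1 ≤ k) hn
    have h2 : ((satFormulas n k (M + j)).card : ℝ) * ((n - 2).choose k - (M + j) : ℕ) ≤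
        (satFormulas n k (M + (j + 1))).card * ((M + j + 1 : ℕ) : ℝ) := by exact_mod_cast h1
    calc ((satFormulas n k (M + j)).card : ℝ) * β
        ≤ ((satFormulas n k (M + j)).card : ℝ) * ((n - 2).choose k - (M + j) : ℕ) := by
          gcongr
          refine hα'.trans ?_
          exact_mod_cast (by omega)
      _ ≤ _ := h2
      _ ≤ _ := by
          gcongr
          refine le_trans ?_ hm2
          exact_mod_cast (by omega)
  have two : ∀ j, j < 3 → ((satFormulas n k (M + j)).card : ℝ) * β ^ 2 ≤
      (satFormulas n k (M + (j + 2))).card * (c₂ * n) ^ 2 := by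
    intro j hj
    calc ((satFormulas n k (M + j)).card : ℝ) * β ^ 2
        = ((satFormulas n k (M + j)).card : ℝ) * β * β := by ring
      _ ≤ (satFormulas n k (M + (j + 1))).card * (c₂ * n) * β := by
          have := step j (by omega)
          gcongr
      _ = (satFormulas n k (M + (j + 1))).card * β * (c₂ * n) := by ring
      _ ≤ (satFormulas n k (M + (j + 2))).card * (c₂ * n) * (c₂ * n) := by
          have := step (j + 1) (by omega)
          gcongr
      _ = _ := by ring
  have hP : ((sharingPairs n k).card : ℝ) ≤ 4 ^ (k - 1) * (n : ℝ) ^ (2 * k - 2) := by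
    have h1 : ((sharingPairs n k).card : ℝ) ≤ (2 * n : ℝ) ^ (2 * k - 2) := by
      exact_mod_cast card_sharingPairs_le (n := n) (by omega : 2 ≤ k)
    refine h1.trans_eq ?_
    rw [mul_pow]
    congr 1
    rw [show 2 * k - 2 = 2 * (k - 1) by omega, pow_mul]
    norm_num
  -- Pairs of clauses with two common literals carry `n²` less entropy than all pairs, which
  -- offsets the `m²` ways to choose the two clauses of the formula.
  have hDP : (c₂ * n) ^ 2 * ((sharingPairs n k).card : ℝ) ≤ D * β ^ 2 := by
    calc (c₂ * n) ^ 2 * ((sharingPairs n k).card : ℝ)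
        ≤ (c₂ * n) ^ 2 * (4 ^ (k - 1) * (n : ℝ) ^ (2 * k - 2)) := by gcongr
      _ = c₂ ^ 2 * 4 ^ (k - 1) * ((n : ℝ) ^ 2 * (n : ℝ) ^ (2 * k - 2)) := by ring
      _ = c₂ ^ 2 * 4 ^ (k - 1) * ((n : ℝ) ^ k) ^ 2 := by
          rw [← pow_add, ← pow_mul]; congr 2; omega
      _ = D * β ^ 2 := by rw [hD, hβ]; field_simp
  set s4 : ℝ := ((satFormulas n k (M + 4)).card : ℝ)
  have hsh : ∀ j, j < 3 → ((satFormulas n k (M + j)).card : ℝ) * (sharingPairs n k).card ≤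
      D * (satFormulas n k (M + (j + 2))).card := by
    intro j hj
    refine le_of_mul_le_mul_right ?_ (by positivity : 0 < β ^ 2)
    calc ((satFormulas n k (M + j)).card : ℝ) * (sharingPairs n k).card * β ^ 2
        = (satFormulas n k (M + j)).card * β ^ 2 * (sharingPairs n k).card := by ring
      _ ≤ (satFormulas n k (M + (j + 2))).card * (c₂ * n) ^ 2 * (sharingPairs n k).card := by
          have := two j hj
          gcongr
      _ = (satFormulas n k (M + (j + 2))).card * ((c₂ * n) ^ 2 * (sharingPairs n k).card) := by ring
      _ ≤ (satFormulas n k (M + (j + 2))).card * (D * β ^ 2) := by gcongr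
      _ = _ := by ring
  have f2 := hsh 2 (by omega)
  have f0 := hsh 0 (by omega)
  simp only [add_zero, zero_add] at f0
  push_cast
  calc 2 * (((satFormulas n k (M + 2)).card : ℝ) * (sharingPairs n k).card) +
        (satFormulas n k M).card * ((sharingPairs n k).card : ℝ) ^ 2
      = 2 * (((satFormulas n k (M + 2)).card : ℝ) * (sharingPairs n k).card) +
        (satFormulas n k M).card * ((sharingPairs n k).card : ℝ) * (sharingPairs n k).card := by
        ring
    _ ≤ 2 * (D * s4) + D * (satFormulas n k (M + 2)).card * (sharingPairs n k).card := by
        gcongr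
    _ = 2 * (D * s4) + D * ((satFormulas n k (M + 2)).card * (sharingPairs n k).card) := by ring
    _ ≤ 2 * (D * s4) + D * (D * s4) := by gcongr
    _ = _ := by ring

open Classical in
/-- In a random satisfiable formula of any positive density, a double edge occurs with probability
bounded away from zero. -/
lemma exists_double_edge_probability {k : ℕ} (hk : 3 ≤ k) {c₁ : ℝ} (hc₁ : 0 < c₁) :
    ∃ δ : ℝ, 0 < δ ∧ ∀ᶠ n : ℕ in atTop,
      δ * (satFormulas n k ⌈c₁ * n⌉₊).card ≤
        ∑ F ∈ satFormulas n k ⌈c₁ * n⌉₊, ∑ σ ∈ sols F,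
          1 / ((sols F).card : ℝ) * (if (doubleEdges F σ).Nonempty then 1 else 0) := by
  set c₂ := c₁ + 1 with hc₂def
  have hc₂ : 0 < c₂ := by positivity
  set α : ℝ := 1 / (2 * 2 ^ k * k.factorial) with hα
  have hα0 : 0 < α := by positivity
  set C : ℝ := c₂ * 2 ^ (k + 1) / α with hC
  set γ : ℝ := 1 / (8 ^ (k - 2) * (k - 2).factorial) with hγ
  have hγ0 : 0 < γ := by positivity
  set c : ℝ := γ ^ 2 * Real.exp (-C) * c₁ ^ 2 / (256 * 4 ^ k) with hcdef
  set B : ℝ := 2 * (c₂ ^ 2 * 4 ^ (k - 1) / α ^ 2) + (c₂ ^ 2 * 4 ^ (k - 1) / α ^ 2) ^ 2 with hBdef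
  have hc : 0 < c := by positivity
  have hB : 0 < B := by positivity
  refine ⟨c ^ 2 / B, by positivity, ?_⟩
  have ev : ∀ R : ℝ, ∀ᶠ n : ℕ in atTop, R ≤ (n : ℝ) := fun R =>
    tendsto_natCast_atTop_atTop.eventually_ge_atTop R
  filter_upwards [ev (8 * k + 4), ev (c₂ / α), ev (2 / γ), ev (4 / c₁)] with n hn1 hn2 hn3 hn4
  have hkr : (3 : ℝ) ≤ k := by exact_mod_cast hk
  have hn0 : (0 : ℝ) < n := by linarith
  have hn4' : 4 ≤ n := by
    have : (4 : ℝ) ≤ n := by linarith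
    exact_mod_cast this
  have hmlow : c₁ * n ≤ (⌈c₁ * n⌉₊ : ℝ) := Nat.le_ceil _
  have hmup : (⌈c₁ * n⌉₊ : ℝ) ≤ c₂ * n := by
    have h1 := (Nat.ceil_lt_add_one (by positivity : 0 ≤ c₁ * (n : ℝ))).le
    have : (1 : ℝ) ≤ n := by linarith
    rw [hc₂def]
    linarith
  obtain ⟨M, hM⟩ : ∃ M, ⌈c₁ * n⌉₊ = M + 4 := by
    have h1 : (4 : ℝ) ≤ c₁ * n := by
      rw [div_le_iff₀ hc₁] at hn4; linarith
    have h2 : ((4 : ℕ) : ℝ) ≤ (⌈c₁ * n⌉₊ : ℝ) := by push_cast; linarith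
    exact ⟨⌈c₁ * n⌉₊ - 4, by have := Nat.cast_le.1 h2; omega⟩
  rw [hM] at hmlow hmup ⊢
  have hα4 : α * (n : ℝ) ^ k ≤ ((n - 2).choose k - (M + 4) : ℕ) := by
    have h1 : ((n : ℝ) / 2) ^ k / k.factorial ≤ ((n - 2).choose k : ℝ) := by
      refine pow_div_le_choose (by positivity) ?_
      rw [Nat.cast_sub (by omega)]
      push_cast
      linarith
    have h2 : ((n : ℝ) / 2) ^ k / k.factorial = 2 * (α * (n : ℝ) ^ k) := by
      rw [hα, div_pow]; field_simp
    have h3 : c₂ * n ≤ α * (n : ℝ) ^ k := by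
      rw [div_le_iff₀ hα0] at hn2
      have h4 : (n : ℝ) ^ 2 ≤ (n : ℝ) ^ k :=
        pow_le_pow_right₀ (by linarith) (by omega)
      calc c₂ * n ≤ n * α * n := by gcongr
        _ = α * (n : ℝ) ^ 2 := by ring
        _ ≤ _ := by gcongr
    rw [Nat.cast_sub]
    · linarith
    · have : ((M + 4 : ℕ) : ℝ) ≤ ((n - 2).choose k : ℝ) := by
        have : 0 ≤ α * (n : ℝ) ^ k := by positivity
        linarith
      exact_mod_cast this
  have hα2 : α * (n : ℝ) ^ k ≤ ((n - 2).choose k - (M + 2) : ℕ) := by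
    refine hα4.trans ?_
    exact_mod_cast (by omega)
  have hC2 : ((M + 2 : ℕ) : ℝ) * (4 * (2 * n) ^ (k - 1)) ≤
      C * ((n - 2).choose k - (M + 2) : ℕ) := by
    have h1 : ((M + 2 : ℕ) : ℝ) ≤ c₂ * n := by
      refine le_trans ?_ hmup
      exact_mod_cast (by omega)
    calc ((M + 2 : ℕ) : ℝ) * (4 * (2 * n) ^ (k - 1)) ≤ c₂ * n * (4 * (2 * n) ^ (k - 1)) := by gcongr
      _ = C * (α * (n : ℝ) ^ k) := by
          have h2 : (2 : ℝ) ^ (k + 1) = 4 * 2 ^ (k - 1) := by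
            rw [show k + 1 = k - 1 + 2 by omega, pow_add]; ring
          have h3 : (n : ℝ) ^ k = n ^ (k - 1) * n := by
            rw [← pow_succ]; congr 1; omega
          rw [hC, mul_pow, h2, h3]
          field_simp
      _ ≤ _ := by
          have : 0 ≤ C := by positivity
          gcongr
  have hγ2 : ∀ x : ℕ, n / 4 ≤ x → 2 ≤ x.choose (k - 2) ∧
      γ * (n : ℝ) ^ (k - 2) ≤ (x.choose (k - 2) : ℝ) := by
    intro x hx
    have h1 : ((n : ℝ) / 8) ^ (k - 2) / (k - 2).factorial ≤ (x.choose (k - 2) : ℝ) := by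
      refine pow_div_le_choose (by positivity) ?_
      rw [Nat.cast_sub (by omega)]
      push_cast
      have : n ≤ 4 * (x + 1) := by omega
      have : (n : ℝ) ≤ 4 * (x + 1) := by exact_mod_cast this
      linarith
    have h2 : ((n : ℝ) / 8) ^ (k - 2) / (k - 2).factorial = γ * (n : ℝ) ^ (k - 2) := by
      rw [hγ, div_pow]; field_simp
    rw [h2] at h1
    refine ⟨?_, h1⟩
    rw [div_le_iff₀ hγ0] at hn3
    have h3 : (n : ℝ) ≤ (n : ℝ) ^ (k - 2) := le_self_pow₀ (by linarith) (by omega)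
    have : (2 : ℝ) ≤ (x.choose (k - 2) : ℝ) := by
      calc (2 : ℝ) ≤ n * γ := hn3
        _ ≤ (n : ℝ) ^ (k - 2) * γ := by gcongr
        _ = γ * (n : ℝ) ^ (k - 2) := by ring
        _ ≤ _ := h1
    exact_mod_cast this
  exact second_moment hc hB
    (first_moment_lower hk hα0 hc₁ (by positivity) hγ0 hn4' hmlow hα2 hC2 hγ2)
    (second_moment_upper hk hα0 hc₂ (by omega) hmup hα4)

open Classical in
/-- An event that excludes double edges misses the probability of a double edge. -/
lemma decimationPr_mul_card_le {k m : ℕ} {E : CNF n → (Fin n → Bool) → Prop}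
    (hE : ∀ F ∈ satFormulas n k m, ∀ σ ∈ sols F, (doubleEdges F σ).Nonempty →
      ¬ E (CNF.ofClauses F) σ) (hpos : 0 < (satFormulas n k m).card) :
    decimationPr n k m E * (satFormulas n k m).card ≤ (satFormulas n k m).card -
      ∑ F ∈ satFormulas n k m, ∑ σ ∈ sols F,
          1 / ((sols F).card : ℝ) * (if (doubleEdges F σ).Nonempty then 1 else 0) := by
  have h0 : ((satFormulas n k m).card : ℝ) ≠ 0 := by positivity
  have hcard : ((satFormulas n k m).card : ℝ) = ∑ _F ∈ satFormulas n k m, (1 : ℝ) := by simp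
  rw [decimationPr, div_mul_cancel₀ _ h0]
  conv_rhs => rw [hcard]
  rw [← Finset.sum_sub_distrib]
  refine Finset.sum_le_sum fun F hF => ?_
  have hne := (mem_satFormulas.1 hF).2.2
  have hrhs : ∑ σ ∈ sols F, (1 / ((sols F).card : ℝ) -
      1 / ((sols F).card : ℝ) * (if (doubleEdges F σ).Nonempty then 1 else 0)) =
      1 - ∑ σ ∈ sols F,
        1 / ((sols F).card : ℝ) * (if (doubleEdges F σ).Nonempty then 1 else 0) := by
    rw [Finset.sum_sub_distrib, sum_sols_inv hne]
  rw [← hrhs]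
  simp only [decimationProb_ofClauses F _ hne]
  rw [← Finset.sum_filter, Finset.filter_filter]
  calc _ ≤ ∑ σ ∈ (sols F).filter (fun σ => ¬ (doubleEdges F σ).Nonempty),
        1 / ((sols F).card : ℝ) := by
        refine Finset.sum_le_sum_of_subset_of_nonneg (fun σ hσ => ?_) fun _ _ _ => by positivity
        obtain ⟨-, h1, h2⟩ := Finset.mem_filter.1 hσ
        exact Finset.mem_filter.2 ⟨mem_sols.2 h2, fun h => hE F hF σ (mem_sols.2 h2) h h1⟩
    _ = _ := by
        rw [Finset.sum_filter]
        refine Finset.sum_congr rfl fun σ _ => ?_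
        by_cases h : (doubleEdges F σ).Nonempty <;> simp only [h] <;> simp

/-- Any `ε ≤ 1/40` works, as BP is off by at least `1/39` at a double edge, whatever `ω` is. -/
theorem not_bpHypothesis {k : ℕ} (hk : 3 ≤ k) {ρ : ℝ} (hρ : 0 < ρ) : ¬ BPHypothesis k ρ := by
  classical
  intro hyp
  obtain ⟨ω, -, hlim⟩ := hyp (1 / 40) (by norm_num)
  have hk0 : (0 : ℝ) < k := by exact_mod_cast (by omega : 0 < k)
  obtain ⟨δ, hδ, hev⟩ := exists_double_edge_probability hk (by positivity : 0 < ρ * 2 ^ k / k)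
  have hle : ∀ᶠ n : ℕ in atTop,
      decimationPr n k (numClauses k ρ n) (fun Φ σ => ∀ t : Fin n,
        |(Φ.decimate σ t).bpMarginal (ω n) t - (Φ.decimate σ t).marginal t| < 1 / 40) ≤
          max 0 (1 - δ) := by
    filter_upwards [hev] with n hn
    rcases Nat.eq_zero_or_pos (satFormulas n k (numClauses k ρ n)).card with h0 | h0
    -- Without satisfiable formulas `decimationPr` is `0 / 0 = 0`, which is no obstacle.
    · rw [decimationPr, h0]
      simp
    · refine le_max_of_le_right ?_
      have h0' : (0 : ℝ) < (satFormulas n k (numClauses k ρ n)).card := by exact_mod_cast h0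
      refine le_of_mul_le_mul_right ?_ h0'
      refine (decimationPr_mul_card_le ?_ h0).trans ?_
      · intro F _ σ hσ hne hall
        obtain ⟨⟨a, b⟩, hab⟩ := hne
        obtain ⟨-, x, y, h⟩ := Finset.mem_filter.1 hab
        exact absurd (hall x) (not_lt.2 (h.le_abs_sub (mem_sols.1 hσ) (ω n)))
      · rw [sub_mul, one_mul]
        exact sub_le_sub_left hn _
  have := le_of_tendsto hlim hle
  rcases le_max_iff.1 this with h | h <;> linarith

end DecimationSAT

end

theorem mainTheorem6 :
    ∃ (k₀ : ℕ) (ρ₀ : ℝ), 0 < k₀ ∧ 0 < ρ₀ ∧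
      ∀ k : ℕ, k₀ ≤ k → ∀ ρ : ℝ, ρ₀ ≤ ρ →
        ρ ≤ (k : ℝ) * Real.log 2 - 3 * Real.log (k : ℝ) →
          ¬ DecimationSAT.BPHypothesis k ρ :=
  ⟨3, 1, by norm_num, by norm_num, fun _ hk _ hρ _ =>
    DecimationSAT.not_bpHypothesis hk (by linarith)⟩
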